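/- Let $d\in\{2,3\}$, let $\Omega\subset\mathbb R^d$ be a bounded polyhedral domain (open, connected, lying on one side of its boundary) and $\nu>0$. Let $\mathcal T_h$ be a conforming Delaunay triangulation of $\Omega$, $h_\triangle$ the diameter of an element $\triangle$ and $h=\max_\triangle h_\triangle$. Let $\{p_i\}$ be its vertices and $B_i=\{x\in\overline\Omega: |x-p_i|\le|x-p_j|\ \forall j\}$ the Voronoi cells. The boxes $\mathcal B_h$ are the cells of the interior vertices; they are assumed not to be truncated by $\partial\Omega$, i.e. the full Voronoi cell of an interior vertex lies in $\overline\Omega$. For two cells put $F_{ij}=B_i\cap B_j$, let $G_i$ be the set of cells $B_j$ (boundary vertices included), $j\neq i$, with $(d-1)$-dimensional measure $|F_{ij}|>0$, and let $\mathcal F_h$ be the set of such faces with at least one of $p_i,p_j$ interior. Let $d_{ij}=|p_i-p_j|$, $n_{ij}=(p_j-p_i)/d_{ij}$, and $w_{ij}$ the distance of $p_j$ from the hyperplane of $F_{ij}$ divided by $d_{ij}$ (so $w_{ij}=\tfrac12$). The mesh is regular with constants $\sigma,\delta,\kappa>0$: each $\triangle$ contains a ball of radius $\sigma h_\triangle$;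 $h_\triangle\ge\delta h$; for every cell $B_i$ there is an element $\triangle$ meeting $B_i$ with $|B_i|\simeq h_\triangle^d$, and for every face $F_{ij}$, $B_j\in G_i$, there is an element $\triangle$ meeting $B_i$ with $d_{ij}\simeq h_\triangle$ and $|F_{ij}|\simeq h_\triangle^{d-1}$, where $a\simeq b$ means $\kappa^{-1}b\le a\le\kappa b$. Let $\mathcal V_h$ be the continuous functions on $\overline\Omega$ that are affine on each element, $\boldsymbol{\mathcal V}_h=\mathcal V_h^d$, $\boldsymbol{\mathcal V}_{h,0}=\{w_h\in\boldsymbol{\mathcal V}_h: w_h=0\text{ on }\partial\Omega\}$ and $\Pi_hv=\sum_{B_i\in\mathcal B_h}v(p_i)\chi_{B_i}$. For a function $v$ on $\overline\Omega$ write $v_i=v(p_i)$ and $\{v\}_{ij}=w_{ij}v_i+(1-w_{ij})v_j$. With $D_i=\sum_{B_j\in G_i}\nu|F_{ij}|/d_{ij}$ and $g_i(q)=\sum_{B_j\in G_i}|F_{ij}|\{q\}_{ij}n_{ij}$ put $$\begin{aligned} a_B(v,\Pi_hw)&=-\sum_{B_i\in\mathcal B_h}\int_{\partial B_i}\nu\,\frac{\partial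 v}{\partial n_i}\cdot w_i\,ds,\\ \tilde b_B(\Pi_hw,q)&=\sum_{B_i\in\mathcal B_h}\sum_{B_j\in G_i}|F_{ij}|\,\{q\}_{ij}\,n_{ij}\cdot w_i,\qquad \tilde c_B(v,\Pi_hz)=\sum_{B_i\in\mathcal B_h}\sum_{B_j\in G_i}|F_{ij}|\,\{v\}_{ij}\cdot n_{ij}\,z_i,\\ \tilde s_B(q,\Pi_hz)&=\sum_{B_i\in\mathcal B_h}\sum_{B_j\in G_i}|F_{ij}|\Bigl[w_{ij}D_i^{-1}g_i(q)+(1-w_{ij})D_j^{-1}g_j(q)\Bigr]\cdot n_{ij}\,z_i\\ &\quad-\sum_{B_i\in\mathcal B_h}\sum_{B_j\in G_i}|F_{ij}|\Bigl[w_{ij}|B_i|D_i^{-1}+(1-w_{ij})|B_j|D_j^{-1}\Bigr]\frac{q_j-q_i}{d_{ij}}\,z_i, \end{aligned}$$ and $\widetilde{\mathcal C}_B((v,q),(\Pi_hw,\Pi_hz))=a_B(v,\Pi_hw)+\tilde b_B(\Pi_hw,q)+\tilde c_B(v,\Pi_hz)+\tilde s_B(q,\Pi_hz)$. Let $$|||(w,z)|||_{box}^2=|w|_{H^1(\Omega)}^2+\|\Pi_hz\|_{L^2(\Omega)}^2+|z|_{\triangle,*}^2,\qquad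 |z|_{\triangle,*}^2=\sum_{F_{ij}\in\mathcal F_h}h_{\triangle}^3d_{ij}\int_{F_{ij}}\Bigl|\frac{\partial z}{\partial n_{ij}}\Bigr|^2ds,$$ where $h_\triangle$ in the last sum is the smallest diameter of the elements meeting $F_{ij}$. Then there is a constant $C>0$, depending only on $d$, $\Omega$, $\nu$, $\sigma$, $\delta$, $\kappa$, such that for all such meshes, all $v_h\in\boldsymbol{\mathcal V}_h$, $w_h\in\boldsymbol{\mathcal V}_{h,0}$ and $q_h,z_h\in\mathcal V_h$, $$\widetilde{\mathcal C}_B((v_h,q_h),(\Pi_hw_h,\Pi_hz_h))\le C\left(|v_h|_{H^1(\Omega)}+\|q_h\|_{L^2(\Omega)}+h^{1/2}|q_h|_{H^1(\Omega)}\right)|||(w_h,z_h)|||_{box}.$$ -/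

import Mathlib

open MeasureTheory
open scoped RealInnerProductSpace

noncomputable section

namespace BoxMethod

/-- The Euclidean space `ℝᵈ`. -/
abbrev Pt (d : ℕ) : Type := EuclideanSpace ℝ (Fin d)

/-- A bounded polyhedral domain: a bounded, open, connected set that lies on one side of its boundary
and whose closure is a finite union of convex polytopes. -/
structure IsPolyhedralDomain {d : ℕ} (Ω : Set (Pt d)) : Prop where
  isOpen : IsOpen Ω
  isConnected : IsConnected Ω
  isBounded : Bornology.IsBounded Ω
  interior_closure : interior (closure Ω) = Ω
  polyhedral : ∃ P : Finset (Finset (Pt d)), closure Ω = ⋃ K ∈ P, convexHull ℝ (K : Set (Pt d))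

/-- The closed simplex spanned by a finite set of points. -/
def simplex {d : ℕ} (K : Finset (Pt d)) : Set (Pt d) := convexHull ℝ (K : Set (Pt d))

/-- A conforming triangulation of `Ω`. An element is given by the set of its `d + 1` vertices. -/
structure Triangulation {d : ℕ} (Ω : Set (Pt d)) where
  elements : Finset (Finset (Pt d))
  card_eq : ∀ K ∈ elements, K.card = d + 1
  affineIndependent : ∀ K ∈ elements, AffineIndependent ℝ ((↑) : K → Pt d)
  conforming : ∀ K ∈ elements, ∀ L ∈ elements,
    simplex K ∩ simplex L = convexHull ℝ ((K : Set (Pt d)) ∩ (L : Set (Pt d)))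
  cover : ⋃ K ∈ elements, simplex K = closure Ω

namespace Triangulation

variable {d : ℕ} {Ω : Set (Pt d)} (T : Triangulation Ω)

/-! ### Vertices and mesh size -/

open Classical in
/-- All vertices of the triangulation. -/
def vertices : Finset (Pt d) := T.elements.biUnion id

open Classical in
/-- The interior vertices. -/
def interiorVertices : Finset (Pt d) := T.vertices.filter (fun p => p ∈ Ω)

/-- The mesh size `h`, the largest diameter of an element. -/
def meshSize : ℝ := sSup ((fun K => Metric.diam (simplex K)) '' (T.elements : Set (Finset (Pt d))))

/-- Delaunay: no vertex lies in the open circumball of an element. -/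
def IsDelaunay : Prop :=
  ∀ K ∈ T.elements, ∀ (c : Pt d) (R : ℝ), (∀ p ∈ K, dist p c = R) → ∀ r ∈ T.vertices, R ≤ dist r c

/-! ### The Voronoi dual mesh -/

/-- The full Voronoi cell of `p` in `ℝᵈ` with respect to the vertices of the triangulation. -/
def voronoi (p : Pt d) : Set (Pt d) := {x | ∀ r ∈ T.vertices, dist x p ≤ dist x r}

/-- The dual cell of the vertex `p`, the part of its Voronoi cell in the closed domain.
The boxes are the dual cells of the interior vertices. -/
def cell (p : Pt d) : Set (Pt d) := T.voronoi p ∩ closure Ω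

/-- The boxes lie in the closed domain, so that they are not truncated Voronoi cells. -/
def BoxesInDomain : Prop := ∀ p ∈ T.interiorVertices, T.voronoi p ⊆ closure Ω

/-- The volume `|B_p|`. -/
def cellVol (p : Pt d) : ℝ := volume.real (T.cell p)

/-- The common face `F_{pr}` of the cells of `p` and `r`. -/
def face (p r : Pt d) : Set (Pt d) := T.cell p ∩ T.cell r

/-- The surface measure, the `(d-1)`-dimensional Hausdorff measure normalised as Lebesgue measure. -/
def surface (d : ℕ) : Measure (Pt d) := Measure.euclideanHausdorffMeasure (d - 1)

/-- The area `|F_{pr}|`. -/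
def faceArea (p r : Pt d) : ℝ := (surface d).real (T.face p r)

open Classical in
/-- `G_p`: the vertices whose cell shares a (nondegenerate) face with the cell of `p`. -/
def nbrs (p : Pt d) : Finset (Pt d) := T.vertices.filter (fun r => r ≠ p ∧ 0 < T.faceArea p r)

/-- The unit normal `n_{pr}` of `F_{pr}`, pointing out of the cell of `p`. -/
def normal (p r : Pt d) : Pt d := (dist p r)⁻¹ • (r - p)

/-- The interpolation weight `w_{pr}`: the distance of `r` from the plane of `F_{pr}`, relative to the
distance of `p` and `r`. The plane of `F_{pr}` is the perpendicular bisector of `p` and `r`. -/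
def weight (p r : Pt d) : ℝ :=
  Metric.infDist r (AffineSubspace.perpBisector p r : Set (Pt d)) / dist p r

/-- `a ≃ b` with constant `κ`. -/
def Comparable (κ a b : ℝ) : Prop := κ⁻¹ * b ≤ a ∧ a ≤ κ * b

/-- Mesh regularity: shape regularity with constant `σ`, quasi-uniformity with constant `δ`, and
comparability of distances, face areas and cell volumes with the local element size, with constant
`κ`. -/
structure IsRegular (σ δ κ : ℝ) : Prop where
  shape : ∀ K ∈ T.elements, ∃ c : Pt d, Metric.ball c (σ * Metric.diam (simplex K)) ⊆ simplex K
  quasiUniform : ∀ K ∈ T.elements, δ * T.meshSize ≤ Metric.diam (simplex K)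
  cellVol_comparable : ∀ p ∈ T.vertices, ∃ K ∈ T.elements, (simplex K ∩ T.cell p).Nonempty ∧
    Comparable κ (T.cellVol p) (Metric.diam (simplex K) ^ d)
  face_comparable : ∀ p ∈ T.vertices, ∀ r ∈ T.nbrs p, ∃ K ∈ T.elements,
    (simplex K ∩ T.cell p).Nonempty ∧
    Comparable κ (dist p r) (Metric.diam (simplex K)) ∧
    Comparable κ (T.faceArea p r) (Metric.diam (simplex K) ^ (d - 1))

/-! ### Discrete spaces -/

/-- The space `V_h` of continuous piecewise linear functions (only values on `closure Ω` matter). -/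
def P1 : Set (Pt d → ℝ) :=
  {v | ContinuousOn v (closure Ω) ∧
    ∀ K ∈ T.elements, ∃ A : Pt d →ᵃ[ℝ] ℝ, Set.EqOn v A (simplex K)}

/-- The vector-valued space `V_h ^ d`. -/
def P1Vec : Set (Pt d → Pt d) := {v | ∀ k, (fun x => v x k) ∈ T.P1}

/-- The functions of `V_h ^ d` that vanish on the boundary of the domain. -/
def P1Vec0 : Set (Pt d → Pt d) := {v | v ∈ T.P1Vec ∧ ∀ x ∈ frontier Ω, v x = 0}

open Classical in
/-- The values on the boxes of the lumped function `Π_h v`: the value on `B_p` is `v p`, and there is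
no box for a vertex that is not interior. -/
def lump {F : Type} [Zero F] (v : Pt d → F) : Pt d → F :=
  fun p => if p ∈ T.interiorVertices then v p else 0

open Classical in
/-- The piecewise constant function with value `c p` on each box `B_p`. -/
def boxFun (c : Pt d → ℝ) : Pt d → ℝ :=
  fun x => ∑ p ∈ T.interiorVertices, (T.cell p).indicator (fun _ => c p) x

/-! ### Norms -/

/-- The norm of `L²(Ω)`. -/
def normL2 (Ω : Set (Pt d)) (q : Pt d → ℝ) : ℝ := √(∫ x in Ω, q x ^ 2)

/-- The seminorm of `H¹(Ω)` on piecewise smooth continuous scalar functions. -/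
def seminormH1 (Ω : Set (Pt d)) (q : Pt d → ℝ) : ℝ := √(∫ x in Ω, ‖fderiv ℝ q x‖ ^ 2)

/-- The seminorm of `H¹(Ω) ^ d`. -/
def seminormH1Vec (Ω : Set (Pt d)) (v : Pt d → Pt d) : ℝ :=
  √(∑ k, seminormH1 Ω (fun x => v x k) ^ 2)

/-- The normal derivative `∂q/∂n_{pr}` at a point of the closed domain. -/
def normalDeriv (Ω : Set (Pt d)) (q : Pt d → ℝ) (p r x : Pt d) : ℝ :=
  lineDerivWithin ℝ q (closure Ω) x (normal p r)

/-- The element size `h_△` attached to a face: the smallest diameter of the elements meeting it. -/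
def faceSize (p r : Pt d) : ℝ :=
  sInf ((fun K => Metric.diam (simplex K)) ''
    {K | K ∈ T.elements ∧ (simplex K ∩ T.face p r).Nonempty})

open Classical in
/-- The sum over all faces of boxes of a quantity symmetric in the two adjacent cells. Each face is
met twice by the double sum. -/
def faceSum (f : Pt d → Pt d → ℝ) : ℝ :=
  (1 / 2) * ∑ p ∈ T.vertices, ∑ r ∈ T.nbrs p,
    if p ∈ T.interiorVertices ∨ r ∈ T.interiorVertices then f p r else 0

/-- The mesh dependent seminorm `|q|_{△,*}`. -/
def seminormStar (q : Pt d → ℝ) : ℝ :=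
  √(T.faceSum fun p r =>
    T.faceSize p r ^ 3 * dist p r * ∫ x in T.face p r, normalDeriv Ω q p r x ^ 2 ∂(surface d))

/-- The norm `|||(v, q)|||_box`. -/
def boxNorm (v : Pt d → Pt d) (q : Pt d → ℝ) : ℝ :=
  √(seminormH1Vec Ω v ^ 2 + normL2 Ω (T.boxFun (T.lump q)) ^ 2 + T.seminormStar q ^ 2)

/-! ### Bilinear forms

In the test argument, `W p` is the value of the piecewise constant test function on the box `B_p`.
The boundary of a box `B_p` is the union of its faces `F_{pr}`, `r ∈ G_p`. -/

/-- `a_B(v, W) = - ∑_p ∫_{∂B_p} ν ∂v/∂n · W ds`. -/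
def aB (ν : ℝ) (v W : Pt d → Pt d) : ℝ :=
  -∑ p ∈ T.interiorVertices, ∑ r ∈ T.nbrs p,
    ∫ x in T.face p r, ν * ∑ k, normalDeriv Ω (fun y => v y k) p r x * W p k ∂(surface d)

/-- Linear interpolation on the face `F_{pr}` between the values at `p` and `r`. -/
def interp {F : Type} [AddCommGroup F] [Module ℝ F] (v : Pt d → F) (p r : Pt d) : F :=
  weight p r • v p + (1 - weight p r) • v r

/-- The discrete form `b̃_B(W, q)`. -/
def bB (W : Pt d → Pt d) (q : Pt d → ℝ) : ℝ :=
  ∑ p ∈ T.interiorVertices, ∑ r ∈ T.nbrs p, T.faceArea p r * interp q p r * ⟪normal p r, W p⟫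

/-- The discrete form `c̃_B(v, Z)`. -/
def cB (v : Pt d → Pt d) (Z : Pt d → ℝ) : ℝ :=
  ∑ p ∈ T.interiorVertices, ∑ r ∈ T.nbrs p, T.faceArea p r * ⟪interp v p r, normal p r⟫ * Z p

/-- The diagonal coefficient `D_p` of the matrix of the viscous form. -/
def diag (ν : ℝ) (p : Pt d) : ℝ := ∑ r ∈ T.nbrs p, ν * T.faceArea p r / dist p r

/-- `|B_p|` times the Gauss-Green gradient of `q` on the cell of `p`. -/
def gaussGreen (q : Pt d → ℝ) (p : Pt d) : Pt d :=
  ∑ r ∈ T.nbrs p, (T.faceArea p r * interp q p r) • normal p r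

/-- The Rhie-Chow stabilization `s̃_B(q, Z)`. -/
def sB (ν : ℝ) (q Z : Pt d → ℝ) : ℝ :=
  (∑ p ∈ T.interiorVertices, ∑ r ∈ T.nbrs p, T.faceArea p r *
      ⟪(weight p r * (T.diag ν p)⁻¹) • T.gaussGreen q p
        + ((1 - weight p r) * (T.diag ν r)⁻¹) • T.gaussGreen q r, normal p r⟫ * Z p)
  - ∑ p ∈ T.interiorVertices, ∑ r ∈ T.nbrs p, T.faceArea p r *
      (weight p r * T.cellVol p * (T.diag ν p)⁻¹
        + (1 - weight p r) * T.cellVol r * (T.diag ν r)⁻¹) *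
      ((q r - q p) / dist p r) * Z p

/-- The compact form `C̃_B((v, q), (W, Z))`. -/
def formC (ν : ℝ) (v : Pt d → Pt d) (q : Pt d → ℝ) (W : Pt d → Pt d) (Z : Pt d → ℝ) : ℝ :=
  T.aB ν v W + T.bB W q + T.cB v Z + T.sB ν q Z

end Triangulation

end BoxMethod

end

noncomputable section

namespace BoxMethod

open Triangulation
open scoped Pointwise

/-! Each of the four forms is bounded by `h^d` times a sum over vertices of products of two local
quantities: gradients on nearby elements, or vertex values nearby. Cauchy-Schwarz and the bounded
overlap of these neighbourhoods turn the sums into norms (`sum_nearSlope_sq_le`,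
`sum_nearValue_sq_le`, `sum_interior_sq_le`). The overlap is bounded because cells have volume at
least a constant times `h^d` (`card_vertices_near_le`).

In `aB` and `bB` the flux through a face changes sign when its two cells are exchanged. Since `w`
vanishes at boundary vertices, the sum may run over all vertices, and summation by parts replaces `w
p` by `w p - w r` (`abs_sum_inner_le`). By the Delaunay property, Voronoi neighbours with one of
them interior are joined by an edge (`exists_element_of_nbr`), so the difference is at most `h`
times a gradient nearby.

In `cB` the test function offers no gradient, so `v` has to be differenced. The area-weighted
normals of an untruncated box sum to zero (`sum_faceArea_smul_normal`, an instance of Minkowski's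
relation `sum_area_smul_normal`), hence `v p` may be subtracted from the face values.

In `sB` the inverse of `D_p` is at most of order `h^(2-d)`. Both parts then scale like `h^d` times
nearby values of `q` (`abs_sB_le`), and the `L²` norm of `q` suffices. The `h^(1/2)` term on the
right and the starred seminorm only enlarge the bound.

The normal derivative in `aB` is a directional derivative within the closed domain, taken also where
`q` has a kink. It is bounded by the gradients of the elements touching the point
(`abs_lineDerivWithin_le`), and it is measurable because it depends only on finitely many yes/no
conditions. -/

/-! ### Volumes of prisms. -/

/-- The set swept out by `F` under translation along the segment from `0` to `u`. -/
def sweep {d : ℕ} (F : Set (Pt d)) (u : Pt d) : Set (Pt d) :=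
  (fun z : Pt d × ℝ => z.1 + z.2 • u) '' (F ×ˢ Set.Icc 0 1)

theorem mem_sweep {d : ℕ} {F : Set (Pt d)} {u y : Pt d} :
    y ∈ sweep F u ↔ ∃ x ∈ F, ∃ s : ℝ, 0 ≤ s ∧ s ≤ 1 ∧ x + s • u = y := by
  constructor
  · rintro ⟨⟨x, s⟩, ⟨hx, hs⟩, rfl⟩
    exact ⟨x, hx, s, hs.1, hs.2, rfl⟩
  · rintro ⟨x, hx, s, h0, h1, rfl⟩
    exact ⟨(x, s), ⟨hx, h0, h1⟩, rfl⟩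

theorem isCompact_sweep {d : ℕ} {F : Set (Pt d)} (hF : IsCompact F) (u : Pt d) :
    IsCompact (sweep F u) :=
  (hF.prod isCompact_Icc).image (by fun_prop)

/-- The volume of a prism with base `F` in a hyperplane with unit normal `n`. -/
theorem volume_sweep {d : ℕ} {F : Set (Pt d)} (hF : IsCompact F) {m n u : Pt d} (hn : ‖n‖ = 1)
    (hFm : ∀ x ∈ F, ⟪x - m, n⟫ = 0) (hu : 0 < ⟪u, n⟫) :
    volume (sweep F u) = ENNReal.ofReal ⟪u, n⟫ * surface d F := by
  have hn0 : n ≠ 0 := by rintro rfl; simp at hn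
  have hd : Module.finrank ℝ (Pt d) = d := by simp
  have h := EuclideanGeometry.euclideanHausdorffMeasure_eq_lintegral m hn0
    (isCompact_sweep hF u).measurableSet
  rw [InnerProductSpace.euclideanHausdorffMeasure_eq_volume, hd] at h
  have hmem : ∀ (τ : ℝ) (y : Pt d),
      y ∈ AffineSubspace.mk' (τ • n +ᵥ m) (ℝ ∙ n)ᗮ ↔ ⟪y - m, n⟫ = τ := by
    intro τ y
    rw [AffineSubspace.mem_mk', Submodule.mem_orthogonal_singleton_iff_inner_left]
    simp only [vsub_eq_sub, vadd_eq_add]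
    rw [show y - (τ • n + m) = (y - m) - τ • n by abel, inner_sub_left, inner_smul_left,
      real_inner_self_eq_norm_sq, hn]
    simp [sub_eq_zero]
  -- Cavalieri: the slice at height `τ` is a translate of `F` for `0 ≤ τ ≤ ⟪u, n⟫`, and empty
  -- otherwise.
  have hslice : ∀ τ : ℝ, surface d (sweep F u ∩ AffineSubspace.mk' (τ • n +ᵥ m) (ℝ ∙ n)ᗮ)
      = (Set.Icc 0 ⟪u, n⟫).indicator (fun _ => surface d F) τ := by
    intro τ
    have hin : ∀ x ∈ F, ∀ s : ℝ, ⟪x + s • u - m, n⟫ = s * ⟪u, n⟫ := by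
      intro x hx s
      rw [show x + s • u - m = (x - m) + s • u by abel, inner_add_left, hFm x hx, inner_smul_left]
      simp
    by_cases hτ : τ ∈ Set.Icc 0 ⟪u, n⟫
    · rw [Set.indicator_of_mem hτ]
      have : sweep F u ∩ AffineSubspace.mk' (τ • n +ᵥ m) (ℝ ∙ n)ᗮ
          = ((τ / ⟪u, n⟫) • u) +ᵥ F := by
        ext y
        simp only [Set.mem_inter_iff, SetLike.mem_coe, hmem, mem_sweep, Set.mem_vadd_set]
        constructor
        · rintro ⟨⟨x, hx, s, h0, h1, rfl⟩, hy⟩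
          rw [hin x hx] at hy
          refine ⟨x, hx, ?_⟩
          rw [← hy, mul_div_cancel_right₀ _ hu.ne', vadd_eq_add, add_comm]
        · rintro ⟨x, hx, rfl⟩
          refine ⟨⟨x, hx, τ / ⟪u, n⟫, div_nonneg hτ.1 hu.le, (div_le_one hu).2 hτ.2,
            by rw [vadd_eq_add, add_comm]⟩, ?_⟩
          rw [vadd_eq_add, add_comm, hin x hx, div_mul_cancel₀ _ hu.ne']
      rw [this]
      exact measure_vadd (Measure.euclideanHausdorffMeasure (d - 1)) _ _
    · rw [Set.indicator_of_notMem hτ]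
      convert measure_empty (μ := surface d)
      ext y
      simp only [Set.mem_inter_iff, SetLike.mem_coe, hmem, mem_sweep, Set.mem_empty_iff_false,
        iff_false, not_and]
      rintro ⟨x, hx, s, h0, h1, rfl⟩ hy
      rw [hin x hx] at hy
      exact hτ ⟨hy ▸ mul_nonneg h0 hu.le, hy ▸ mul_le_of_le_one_left hu.le h1⟩
  rw [h]
  have : ‖n‖ₑ = 1 := by rw [← ofReal_norm, hn]; simp
  rw [this, one_mul]
  change ∫⁻ τ, surface d (sweep F u ∩ AffineSubspace.mk' (τ • n +ᵥ m) (ℝ ∙ n)ᗮ) = _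
  simp_rw [hslice]
  rw [lintegral_indicator measurableSet_Icc, setLIntegral_const, Real.volume_Icc, sub_zero, mul_comm]

theorem volume_hyperplane {d : ℕ} {m n : Pt d} (hn : n ≠ 0) :
    volume {x : Pt d | ⟪x - m, n⟫ = 0} = 0 := by
  have h : {x : Pt d | ⟪x - m, n⟫ = 0} = (AffineSubspace.mk' m (ℝ ∙ n)ᗮ : Set (Pt d)) := by
    ext y
    rw [SetLike.mem_coe, AffineSubspace.mem_mk',
      Submodule.mem_orthogonal_singleton_iff_inner_left]
    rfl
  rw [h]
  apply Measure.addHaar_affineSubspace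
  intro htop
  have : m + n ∈ AffineSubspace.mk' m (ℝ ∙ n)ᗮ := by rw [htop]; trivial
  rw [AffineSubspace.mem_mk', Submodule.mem_orthogonal_singleton_iff_inner_left] at this
  simp [hn] at this

/-! ### Minkowski's relation for polytopes, by sweeping. -/

section Polytope

variable {d : ℕ} {ι : Type*}

/-- The intersection of half spaces with outer normals `n i` and boundary points `m i`. -/
def polytope (I : Finset ι) (m n : ι → Pt d) : Set (Pt d) := {x | ∀ i ∈ I, ⟪x - m i, n i⟫ ≤ 0}

/-- The part of the polytope in the `i`-th boundary hyperplane. -/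
def facet (I : Finset ι) (m n : ι → Pt d) (i : ι) : Set (Pt d) :=
  polytope I m n ∩ {x | ⟪x - m i, n i⟫ = 0}

variable {I : Finset ι} {m n : ι → Pt d}

theorem isCompact_facet (hP : IsCompact (polytope I m n)) (i : ι) :
    IsCompact (facet I m n i) :=
  hP.inter_right (isClosed_eq (by fun_prop) continuous_const)

/-- A point moving along `u` leaves the polytope through a facet whose outer normal makes an acute
angle with `u`; from then on it lies in the prism over that facet. -/
theorem sweep_polytope (hP : IsCompact (polytope I m n)) (u : Pt d) :
    sweep (polytope I m n) u = polytope I m n ∪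
      ⋃ i ∈ I.filter (fun i => 0 < ⟪u, n i⟫), sweep (facet I m n i) u := by
  apply Set.Subset.antisymm
  · intro y hy
    rw [mem_sweep] at hy
    obtain ⟨x, hx, s, h0, h1, rfl⟩ := hy
    by_cases hyP : x + s • u ∈ polytope I m n
    · exact Or.inl hyP
    right
    let S : Set ℝ := Set.Icc 0 s ∩ (fun t : ℝ => x + t • u) ⁻¹' polytope I m n
    have hS : IsCompact S := isCompact_Icc.inter_right (hP.isClosed.preimage (by fun_prop))
    have hSne : S.Nonempty := ⟨0, ⟨le_rfl, h0⟩, by simpa using hx⟩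
    obtain ⟨t, ⟨⟨ht0, hts⟩, htP⟩, htmax⟩ := hS.exists_isGreatest hSne
    have hlt : t < s := lt_of_le_of_ne hts (by rintro rfl; exact hyP htP)
    have hg : ∀ i (τ : ℝ), ⟪x + τ • u - m i, n i⟫ = ⟪x + t • u - m i, n i⟫ + (τ - t) * ⟪u, n i⟫ := by
      intro i τ
      rw [show x + τ • u - m i = (x + t • u - m i) + (τ - t) • u by rw [sub_smul]; abel,
        inner_add_left, inner_smul_left]
      simp
    -- `t` is the last time on the segment spent in the polytope. If no active constraint increased
    -- along `u`, all finitely many constraints would still hold slightly later.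
    have hex : ∃ i ∈ I, ⟪x + t • u - m i, n i⟫ = 0 ∧ 0 < ⟪u, n i⟫ := by
      by_contra hcon
      push Not at hcon
      have hev : ∀ i ∈ I, ∀ᶠ τ in nhdsWithin t (Set.Ioi t), ⟪x + τ • u - m i, n i⟫ ≤ 0 := by
        intro i hi
        rcases (htP i hi).lt_or_eq with hlt0 | heq
        · have hc : Continuous fun τ : ℝ => ⟪x + τ • u - m i, n i⟫ := by fun_prop
          exact ((hc.tendsto t).eventually (gt_mem_nhds hlt0)).filter_mono
            nhdsWithin_le_nhds |>.mono fun τ h => le_of_lt h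
        · filter_upwards [self_mem_nhdsWithin] with τ hτ
          rw [hg i τ, heq, zero_add]
          exact mul_nonpos_of_nonneg_of_nonpos (sub_nonneg.2 (le_of_lt hτ)) (hcon i hi heq)
      have hall := (Filter.eventually_all_finset I).2 hev
      obtain ⟨τ, hτ, hτt, hτs⟩ := (hall.and (Ioo_mem_nhdsGT hlt)).exists
      exact absurd (htmax ⟨⟨ht0.trans hτt.le, hτs.le⟩, hτ⟩) (not_le.2 hτt)
    obtain ⟨i, hi, hi0, hipos⟩ := hex
    refine Set.mem_biUnion (x := i) (by simp [hi, hipos]) ?_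
    rw [mem_sweep]
    refine ⟨x + t • u, ⟨htP, hi0⟩, s - t, sub_nonneg.2 hts, by linarith, ?_⟩
    rw [sub_smul]; abel
  · rintro y (hy | hy)
    · exact mem_sweep.2 ⟨y, hy, 0, le_rfl, zero_le_one, by simp⟩
    · simp only [Set.mem_iUnion] at hy
      obtain ⟨i, -, hy⟩ := hy
      obtain ⟨x, hx, s, h0, h1, rfl⟩ := mem_sweep.1 hy
      exact mem_sweep.2 ⟨x, hx.1, s, h0, h1, rfl⟩

/-- The pieces of `sweep_polytope` overlap in null sets only: a prism meets the polytope in a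
hyperplane, and two prisms meet in the prism over the intersection of their facets. -/
theorem volume_sweep_polytope (hP : IsCompact (polytope I m n)) (hn : ∀ i ∈ I, ‖n i‖ = 1)
    (hdisj : ∀ i ∈ I, ∀ j ∈ I, i ≠ j → surface d (facet I m n i ∩ facet I m n j) = 0) (u : Pt d) :
    volume (sweep (polytope I m n) u) = volume (polytope I m n) +
      ∑ i ∈ I, ENNReal.ofReal ⟪u, n i⟫ * surface d (facet I m n i) := by
  have hms : ∀ i, MeasurableSet (sweep (facet I m n i) u) := fun i =>
    (isCompact_sweep (isCompact_facet hP i) u).measurableSet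
  -- From a facet with `0 < ⟪u, n i⟫` the ray leaves the polytope at once, so the exit time and the
  -- exit point of a swept point are unique.
  have hstep : ∀ i ∈ I, 0 < ⟪u, n i⟫ → ∀ x ∈ facet I m n i, ∀ s : ℝ,
      x + s • u ∈ polytope I m n → s ≤ 0 := by
    intro i hi hpos x hx s hs
    have h1 := hs i hi
    rw [show x + s • u - m i = (x - m i) + s • u by abel, inner_add_left, hx.2,
      inner_smul_left] at h1
    simp only [conj_trivial, zero_add] at h1
    by_contra hcon
    exact absurd (mul_pos (not_le.1 hcon) hpos) (not_lt.2 h1)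
  rw [sweep_polytope hP u, measure_union₀, measure_biUnion_finset₀]
  · congr 1
    rw [Finset.sum_filter]
    refine Finset.sum_congr rfl fun i hi => ?_
    split_ifs with h
    · exact volume_sweep (isCompact_facet hP i) (hn i hi) (fun x hx => hx.2) h
    · rw [ENNReal.ofReal_of_nonpos (not_lt.1 h), zero_mul]
  · intro i hi j hj hij
    simp only [Finset.coe_filter, Set.mem_ofPred_eq] at hi hj
    refine measure_mono_null (t := sweep (facet I m n i ∩ facet I m n j) u) ?_ ?_
    · rintro y ⟨hyi, hyj⟩
      obtain ⟨x, hx, s, h0, h1, rfl⟩ := mem_sweep.1 hyi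
      obtain ⟨x', hx', s', h0', h1', he⟩ := mem_sweep.1 hyj
      have e1 : x = x' + (s' - s) • u := by
        rw [sub_smul, add_sub, he]; abel
      have e2 : x' = x + (s - s') • u := by
        rw [sub_smul, add_sub, ← he]; abel
      have := hstep j hj.1 hj.2 x' hx' (s' - s) (e1 ▸ hx.1)
      have := hstep i hi.1 hi.2 x hx (s - s') (e2 ▸ hx'.1)
      have hss : s = s' := by linarith
      subst hss
      have : x = x' := by simpa using e1
      subst this
      exact mem_sweep.2 ⟨x, ⟨hx, hx'⟩, s, h0, h1, rfl⟩
    · rw [volume_sweep ((isCompact_facet hP i).inter (isCompact_facet hP j)) (hn i hi.1)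
        (fun x hx => hx.1.2) hi.2, hdisj i hi.1 j hj.1 hij, mul_zero]
  · intro i _
    exact (hms i).nullMeasurableSet
  · exact (Finset.measurableSet_biUnion _ fun i _ => hms i).nullMeasurableSet
  · rw [AEDisjoint, Set.inter_iUnion₂]
    refine (measure_biUnion_null_iff (Finset.countable_toSet _)).2 fun i hi => ?_
    simp only [Finset.coe_filter, Set.mem_ofPred_eq] at hi
    have hn0 : n i ≠ 0 := by intro h; simpa [h] using hn i hi.1
    refine measure_mono_null ?_ (volume_hyperplane (m := m i) hn0)
    rintro y ⟨hyP, hy⟩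
    obtain ⟨x, hx, s, h0, h1, rfl⟩ := mem_sweep.1 hy
    have : s = 0 := le_antisymm (hstep i hi.1 hi.2 x hx s hyP) h0
    subst this
    simpa using hx.2

theorem surface_facet_lt_top (hP : IsCompact (polytope I m n)) {i : ι} (hn : ‖n i‖ = 1) :
    surface d (facet I m n i) < ⊤ := by
  have h1 : ⟪n i, n i⟫ = 1 := by rw [real_inner_self_eq_norm_sq, hn]; norm_num
  have h := volume_sweep (isCompact_facet hP i) hn (fun x hx => hx.2) (u := n i) (by rw [h1]; simp)
  rw [h1, ENNReal.ofReal_one, one_mul] at h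
  rw [← h]
  exact (isCompact_sweep (isCompact_facet hP i) _).measure_lt_top

/-- Minkowski's relation: the facet normals of a polytope, weighted by area, sum to zero. -/
theorem sum_area_smul_normal (hP : IsCompact (polytope I m n)) (hn : ∀ i ∈ I, ‖n i‖ = 1)
    (hdisj : ∀ i ∈ I, ∀ j ∈ I, i ≠ j → surface d (facet I m n i ∩ facet I m n j) = 0) :
    ∑ i ∈ I, (surface d).real (facet I m n i) • n i = 0 := by
  -- With `u` the sum itself, the goal becomes `⟪u, u⟫ = 0`. Sweeping along `u` and along `-u` gives
  -- translates of one another, hence equal volumes, and the two volume formulas differ by the sum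
  -- of area times `⟪u, n i⟫`, which is `⟪u, u⟫`.
  rw [← inner_self_eq_zero (𝕜 := ℝ)]
  generalize hu : ∑ i ∈ I, (surface d).real (facet I m n i) • n i = u
  nth_rewrite 2 [← hu]
  rw [inner_sum]
  simp_rw [inner_smul_right]
  have hvol : volume (sweep (polytope I m n) u) = volume (sweep (polytope I m n) (-u)) := by
    have : sweep (polytope I m n) u = u +ᵥ sweep (polytope I m n) (-u) := by
      ext y
      simp only [Set.mem_vadd_set, mem_sweep, vadd_eq_add]
      constructor
      · rintro ⟨x, hx, s, h0, h1, rfl⟩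
        refine ⟨x + (1 - s) • (-u), ⟨x, hx, 1 - s, by linarith, by linarith, rfl⟩, ?_⟩
        rw [smul_neg, sub_smul, one_smul]; abel
      · rintro ⟨_, ⟨x, hx, s, h0, h1, rfl⟩, rfl⟩
        refine ⟨x, hx, 1 - s, by linarith, by linarith, ?_⟩
        rw [smul_neg, sub_smul, one_smul]; abel
    rw [this, measure_vadd]
  rw [volume_sweep_polytope hP hn hdisj, volume_sweep_polytope hP hn hdisj,
    ENNReal.add_right_inj hP.measure_lt_top.ne] at hvol
  have hfin : ∀ v : Pt d, ∀ i ∈ I, ENNReal.ofReal ⟪v, n i⟫ * surface d (facet I m n i) ≠ ⊤ :=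
    fun v i hi => ENNReal.mul_ne_top ENNReal.ofReal_ne_top (surface_facet_lt_top hP (hn i hi)).ne
  have h := congrArg ENNReal.toReal hvol
  rw [ENNReal.toReal_sum (hfin u), ENNReal.toReal_sum (hfin (-u)), ← sub_eq_zero,
    ← Finset.sum_sub_distrib] at h
  rw [← h]
  refine Finset.sum_congr rfl fun i _ => ?_
  rw [ENNReal.toReal_mul, ENNReal.toReal_mul, ENNReal.toReal_ofReal', ENNReal.toReal_ofReal',
    inner_neg_left, ← sub_mul, mul_comm, Measure.real]
  congr 1
  rcases le_total 0 ⟪u, n i⟫ with h | h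
  · rw [max_eq_left h, max_eq_right (by linarith)]; ring
  · rw [max_eq_right h, max_eq_left (by linarith)]; ring

end Polytope

/-! ### Bisectors of vertices. -/

/-- The difference of the squared distances is `2 * dist p r` times the signed height over the
bisector. -/
theorem dist_le_dist_iff_inner {d : ℕ} {p r x : Pt d} (h : p ≠ r) :
    dist x p ≤ dist x r ↔ ⟪x - midpoint ℝ p r, normal p r⟫ ≤ 0 := by
  have hpos : 0 < dist p r := dist_pos.2 h
  have key : dist x p ^ 2 - dist x r ^ 2 = 2 * dist p r * ⟪x - midpoint ℝ p r, normal p r⟫ := by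
    have e1 : x - p = (x - midpoint ℝ p r) + (2⁻¹ : ℝ) • (r - p) := by
      rw [midpoint_eq_smul_add, invOf_eq_inv]; module
    have e2 : x - r = (x - midpoint ℝ p r) - (2⁻¹ : ℝ) • (r - p) := by
      rw [midpoint_eq_smul_add, invOf_eq_inv]; module
    rw [dist_eq_norm, dist_eq_norm, e1, e2]
    generalize x - midpoint ℝ p r = y
    rw [norm_add_sq_real, norm_sub_sq_real, normal, inner_smul_right, inner_smul_right]
    field_simp
    ring
  rw [← sub_nonpos (a := ⟪_, _⟫), sub_zero, ← sq_le_sq₀ dist_nonneg dist_nonneg, ← sub_nonpos, key]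
  constructor
  · intro hle
    by_contra hc
    exact absurd (mul_pos (mul_pos two_pos hpos) (not_le.1 hc)) (not_lt.2 hle)
  · intro hle
    exact mul_nonpos_of_nonneg_of_nonpos (by positivity) hle

theorem norm_normal {d : ℕ} {p r : Pt d} (h : p ≠ r) : ‖normal p r‖ = 1 := by
  rw [normal, norm_smul, norm_inv, Real.norm_of_nonneg dist_nonneg, dist_comm, dist_eq_norm]
  exact inv_mul_cancel₀ (norm_ne_zero_iff.2 (sub_ne_zero.2 h.symm))

theorem normal_comm {d : ℕ} (p r : Pt d) : normal r p = -normal p r := by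
  rw [normal, normal, dist_comm, ← smul_neg, neg_sub]

/-- The midpoint realises the distance to the bisector; the triangle inequality through an
equidistant point shows that nothing is closer. -/
theorem weight_eq_half {d : ℕ} {p r : Pt d} (h : p ≠ r) : weight p r = 1 / 2 := by
  have hpos : 0 < dist p r := dist_pos.2 h
  have : Metric.infDist r (AffineSubspace.perpBisector p r : Set (Pt d)) = dist p r / 2 := by
    apply le_antisymm
    · refine (Metric.infDist_le_dist_of_mem
        (AffineSubspace.midpoint_mem_perpBisector p r)).trans_eq ?_
      rw [dist_right_midpoint]; simp; ring
    · refine (Metric.le_infDist AffineSubspace.perpBisector_nonempty).2 fun c hc => ?_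
      rw [SetLike.mem_coe, AffineSubspace.mem_perpBisector_iff_dist_eq] at hc
      have := dist_triangle p c r
      rw [dist_comm p c, hc, dist_comm c r] at this
      linarith
  rw [weight, this]
  field_simp

theorem surface_vadd_orthogonal_span_pair {d : ℕ} {a b : Pt d} (h : LinearIndependent ℝ ![a, b])
    (x : Pt d) : surface d (x +ᵥ ((Submodule.span ℝ {a, b})ᗮ : Set (Pt d))) = 0 := by
  set W := (Submodule.span ℝ {a, b})ᗮ
  have hfr : Module.finrank ℝ W + 2 = d := by
    have h1 := Submodule.finrank_add_finrank_orthogonal (Submodule.span ℝ ({a, b} : Set (Pt d)))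
    have h2 := finrank_span_eq_card h
    have h3 : Set.range ![a, b] = {a, b} := by simp [Set.pair_comm]
    rw [h3, Fintype.card_fin] at h2
    change _ + Module.finrank ℝ W = _ at h1
    rw [h2, finrank_euclideanSpace_fin] at h1
    simp only [Nat.succ_eq_add_one] at h1
    omega
  have hW : (W : Set (Pt d)) = Subtype.val '' (Set.univ : Set W) := by simp
  unfold surface
  rw [measure_vadd, hW, isometry_subtype_coe.euclideanHausdorffMeasure_image,
    Measure.euclideanHausdorffMeasure_def]
  -- Codimension two: the dimension is `d - 2`, and `hfr` ensures `2 ≤ d`, so the truncated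
  -- subtraction is harmless.
  have : (Module.finrank ℝ W : ℝ) < ((d - 1 : ℕ) : ℝ) := by
    rw [Nat.cast_lt]; omega
  simp [Real.hausdorffMeasure_of_finrank_lt this]

/-- If `r - p` and `s - p` are independent, the two bisectors meet in a flat of codimension two. If
they are parallel, the bisectors are distinct parallel hyperplanes and do not meet. -/
theorem surface_two_bisectors {d : ℕ} {p r s : Pt d} (hr : p ≠ r) (hs : p ≠ s) (hrs : r ≠ s) :
    surface d {x : Pt d | dist x p = dist x r ∧ dist x p = dist x s} = 0 := by
  have hin : ∀ x q : Pt d, dist x p = dist x q ↔ ⟪x - p, q - p⟫ = ‖q - p‖ ^ 2 / 2 := by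
    intro x q
    rw [← sq_eq_sq₀ dist_nonneg dist_nonneg, dist_eq_norm, dist_eq_norm,
      show x - q = (x - p) - (q - p) by abel]
    generalize x - p = y
    rw [norm_sub_sq_real]
    constructor <;> intro h <;> linarith
  simp_rw [hin]
  have hr0 : r - p ≠ 0 := sub_ne_zero.2 hr.symm
  by_cases hli : LinearIndependent ℝ ![r - p, s - p]
  · by_cases hne : {x : Pt d | ⟪x - p, r - p⟫ = ‖r - p‖ ^ 2 / 2 ∧
        ⟪x - p, s - p⟫ = ‖s - p‖ ^ 2 / 2}.Nonempty
    · obtain ⟨x0, h1, h2⟩ := hne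
      refine measure_mono_null ?_ (surface_vadd_orthogonal_span_pair hli x0)
      rintro x ⟨g1, g2⟩
      refine ⟨x - x0, ?_, by simp⟩
      rw [SetLike.mem_coe, Submodule.mem_orthogonal']
      intro u hu
      obtain ⟨α, β, rfl⟩ := Submodule.mem_span_pair.1 hu
      rw [inner_add_right, inner_smul_right, inner_smul_right,
        show x - x0 = (x - p) - (x0 - p) by abel, inner_sub_left (x - p), inner_sub_left (x - p),
        h1, h2, g1, g2]
      ring
    · rw [Set.not_nonempty_iff_eq_empty.1 hne, measure_empty]
  · rw [LinearIndependent.pair_iff' hr0] at hli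
    push Not at hli
    obtain ⟨c, hc⟩ := hli
    convert measure_empty (μ := surface d)
    ext x
    simp only [Set.mem_ofPred_eq, Set.mem_empty_iff_false, iff_false, not_and]
    intro h1 h2
    rw [← hc, inner_smul_right, h1, norm_smul, mul_pow, Real.norm_eq_abs, sq_abs] at h2
    have hpos : ‖r - p‖ ^ 2 ≠ 0 := by positivity
    have : c * (c - 1) = 0 := by
      apply mul_right_cancel₀ hpos; linarith
    rcases mul_eq_zero.1 this with h0 | h0
    · rw [h0, zero_smul] at hc
      exact hs (sub_eq_zero.1 hc.symm).symm
    · rw [sub_eq_zero.1 h0, one_smul] at hc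
      exact hrs (sub_left_injective hc)

/-! ### Neighbouring cells and Delaunay edges. -/

namespace Triangulation

variable {d : ℕ} {Ω : Set (Pt d)} {T : Triangulation Ω} {σ δ κ : ℝ}

theorem mem_nbrs {p r : Pt d} :
    r ∈ T.nbrs p ↔ r ∈ T.vertices ∧ r ≠ p ∧ 0 < T.faceArea p r := by
  simp [nbrs]

theorem face_comm (p r : Pt d) : T.face r p = T.face p r := Set.inter_comm _ _

theorem faceArea_comm (p r : Pt d) : T.faceArea r p = T.faceArea p r := by
  rw [faceArea, face_comm, faceArea]

theorem mem_vertices {p : Pt d} : p ∈ T.vertices ↔ ∃ K ∈ T.elements, p ∈ K := by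
  simp [vertices]

theorem mem_interiorVertices {p : Pt d} : p ∈ T.interiorVertices ↔ p ∈ T.vertices ∧ p ∈ Ω := by
  simp [interiorVertices]

theorem nbrs_symm {p r : Pt d} (hp : p ∈ T.vertices) (hr : r ∈ T.nbrs p) : p ∈ T.nbrs r := by
  rw [mem_nbrs] at *
  exact ⟨hp, hr.2.1.symm, by rw [faceArea_comm]; exact hr.2.2⟩

theorem simplex_subset_closure {K : Finset (Pt d)} (hK : K ∈ T.elements) :
    simplex K ⊆ closure Ω := by
  rw [← T.cover]
  exact Set.subset_biUnion_of_mem (u := fun K => simplex K) hK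

theorem subset_simplex {K : Finset (Pt d)} {p : Pt d} (hp : p ∈ K) : p ∈ simplex K :=
  subset_convexHull ℝ _ hp

theorem exists_circumsphere {K : Finset (Pt d)} (hK : K ∈ T.elements) :
    ∃ (c : Pt d) (R : ℝ), ∀ p ∈ K, dist p c = R := by
  have hcard := T.card_eq K hK
  have : Nonempty K := by
    obtain ⟨x, hx⟩ := Finset.card_pos.1 (by omega : 0 < K.card)
    exact ⟨⟨x, hx⟩⟩
  obtain ⟨s, ⟨-, hs⟩, -⟩ := (T.affineIndependent K hK).existsUnique_dist_eq
  exact ⟨s.center, s.radius, fun p hp => hs ⟨⟨p, hp⟩, rfl⟩⟩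

/-- A face has positive area, while its points equidistant from a third vertex form a null set. So
some point of it has `p` and `r` as its only nearest vertices. -/
theorem exists_mem_face_dist_lt {p r : Pt d} (hr : r ∈ T.nbrs p) (hp : p ∈ T.vertices) :
    ∃ x ∈ T.face p r, dist x p = dist x r ∧
      ∀ s ∈ T.vertices, s ≠ p → s ≠ r → dist x p < dist x s := by
  obtain ⟨hrv, hrp, hpos⟩ := mem_nbrs.1 hr
  by_contra hcon
  push Not at hcon
  have heq : ∀ x ∈ T.face p r, dist x p = dist x r := fun x hx =>
    le_antisymm (hx.1.1 r hrv) (hx.2.1 p hp)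
  have hnull : surface d (⋃ s ∈ T.vertices.filter (fun s => s ≠ p ∧ s ≠ r),
      {x : Pt d | dist x p = dist x r ∧ dist x p = dist x s}) = 0 := by
    refine (measure_biUnion_null_iff (Finset.countable_toSet _)).2 fun s hs => ?_
    simp only [Finset.coe_filter, Set.mem_ofPred_eq] at hs
    exact surface_two_bisectors hrp.symm hs.2.1.symm hs.2.2.symm
  have h0 : surface d (T.face p r) = 0 := by
    refine measure_mono_null (fun x hx => ?_) hnull
    obtain ⟨s, hs, hsp, hsr, hle⟩ := hcon x hx (heq x hx)
    refine Set.mem_biUnion (x := s) (by simp [hs, hsp, hsr]) ?_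
    exact ⟨heq x hx, le_antisymm (hx.1.1 s hs) hle⟩
  rw [faceArea, Measure.real, h0] at hpos
  simp at hpos

/-- Voronoi neighbours, one of which is interior, are joined by an edge of a Delaunay
triangulation. -/
theorem exists_element_of_nbr (hDel : T.IsDelaunay) (hΩ : IsOpen Ω) {p r : Pt d}
    (hp : p ∈ T.interiorVertices) (hr : r ∈ T.nbrs p) : ∃ K ∈ T.elements, p ∈ K ∧ r ∈ K := by
  obtain ⟨hpv, hpΩ⟩ := mem_interiorVertices.1 hp
  obtain ⟨hrv, hrp, -⟩ := mem_nbrs.1 hr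
  obtain ⟨x, -, hx, hxs⟩ := exists_mem_face_dist_lt hr hpv
  -- Only a point close to `p` is sure to lie in `Ω`: the rest of the segment may leave the domain.
  obtain ⟨t, htΩ, ht0, ht1⟩ : ∃ t : ℝ, (1 - t) • p + t • r ∈ Ω ∧ 0 < t ∧ t < 1 := by
    have hc : Continuous fun t : ℝ => (1 - t) • p + t • r := by fun_prop
    have h0 : ∀ᶠ t in nhds (0 : ℝ), (1 - t) • p + t • r ∈ Ω :=
      (hc.tendsto 0).eventually (hΩ.mem_nhds (by simpa using hpΩ))
    obtain ⟨t, ht, h1, h2⟩ :=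
      ((h0.filter_mono nhdsWithin_le_nhds).and (Ioo_mem_nhdsGT (zero_lt_one' ℝ))).exists
    exact ⟨t, ht, h1, h2⟩
  set z := (1 - t) • p + t • r with hz
  have hzc : z ∈ ⋃ K ∈ T.elements, simplex K := T.cover ▸ subset_closure htΩ
  simp only [Set.mem_iUnion] at hzc
  obtain ⟨K, hK, hzK⟩ := hzc
  obtain ⟨c, R, hcR⟩ := exists_circumsphere hK
  have hDel' := hDel K hK c R hcR
  have hRnn : 0 ≤ R := by
    obtain ⟨k, hk⟩ := Finset.card_pos.1 (by rw [T.card_eq K hK]; omega : 0 < K.card)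
    exact hcR k hk ▸ dist_nonneg
  -- `f` compares the sphere about `x` through `p` and `r` with the circumsphere of `K`; it is
  -- affine because the squares of `y` cancel. It is nonpositive at `p` and `r` by the Delaunay
  -- property and positive at every other vertex of `K`. Hence at `z`, a combination of either set
  -- of points, it vanishes, and the other vertices carry no weight in `z`.
  let f : Pt d → ℝ := fun y => (dist x y ^ 2 - dist x p ^ 2) - (dist y c ^ 2 - R ^ 2)
  let e : ℝ := ‖x‖ ^ 2 - dist x p ^ 2 - ‖c‖ ^ 2 + R ^ 2
  have hf : ∀ y, f y = ⟪(2 : ℝ) • (c - x), y⟫ + e := by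
    intro y
    simp only [f, e, dist_eq_norm, norm_sub_sq_real, inner_smul_left, inner_sub_left, conj_trivial]
    rw [real_inner_comm c y]; ring
  obtain ⟨w, hw0, hw1, hwz⟩ := Finset.mem_convexHull'.1 hzK
  have hfz1 : f z = ∑ k ∈ K, w k * f k := by
    rw [hf, ← hwz, inner_sum]
    simp_rw [hf, mul_add, Finset.sum_add_distrib, ← Finset.sum_mul, hw1, inner_smul_right, one_mul]
  have hfz2 : f z = (1 - t) * f p + t * f r := by
    rw [hf, hz, inner_add_right, inner_smul_right, inner_smul_right, hf, hf]; ring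
  have hfp : f p ≤ 0 := by
    have := pow_le_pow_left₀ hRnn (hDel' p hpv) 2
    simp only [f]; linarith
  have hfr : f r ≤ 0 := by
    have := pow_le_pow_left₀ hRnn (hDel' r hrv) 2
    simp only [f, hx]; linarith
  have hfk : ∀ k ∈ K, k ≠ p → k ≠ r → 0 < f k := by
    intro k hk h1 h2
    have := pow_lt_pow_left₀ (hxs k (mem_vertices.2 ⟨K, hK, hk⟩) h1 h2) dist_nonneg two_ne_zero
    simp only [f, hcR k hk]; linarith
  have hfk' : ∀ k ∈ K, 0 ≤ f k := by
    intro k hk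
    by_cases h1 : k = p
    · simp only [f, ← hcR k hk, h1, sub_self, le_refl]
    by_cases h2 : k = r
    · simp only [f, ← hcR k hk, h2, hx, sub_self, le_refl]
    exact (hfk k hk h1 h2).le
  have hz0 : f z = 0 := by
    apply le_antisymm
    · rw [hfz2]
      nlinarith [mul_nonneg (sub_nonneg.2 ht1.le) (neg_nonneg.2 hfp),
        mul_nonneg ht0.le (neg_nonneg.2 hfr)]
    · rw [hfz1]
      exact Finset.sum_nonneg fun k hk => mul_nonneg (hw0 k hk) (hfk' k hk)
  have hwk : ∀ k ∈ K, k ≠ p → k ≠ r → w k = 0 := by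
    intro k hk h1 h2
    have := (Finset.sum_eq_zero_iff_of_nonneg
      (fun k hk => mul_nonneg (hw0 k hk) (hfk' k hk))).1 (hfz1 ▸ hz0) k hk
    exact (mul_eq_zero.1 this).resolve_right (hfk k hk h1 h2).ne'
  have hsingle : ∀ a : Pt d, (∀ k ∈ K, k ≠ a → w k = 0) → z = a := by
    intro a ha
    rw [← hwz]
    have : ∀ k ∈ K, w k • k = w k • a := by
      intro k hk
      by_cases h : k = a
      · rw [h]
      · rw [ha k hk h, zero_smul, zero_smul]
    rw [Finset.sum_congr rfl this, ← Finset.sum_smul, hw1, one_smul]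
  -- If only one of `p`, `r` belonged to `K`, then `z` would be that point, against `0 < t < 1`.
  refine ⟨K, hK, ?_, ?_⟩
  · by_contra hpK
    have : z = r := hsingle r fun k hk hkr => hwk k hk (by rintro rfl; exact hpK hk) hkr
    have h2 : (1 - t) • (p - r) = 0 := by
      rw [smul_sub, sub_eq_zero]
      have : (1 - t) • p + t • r = r := this
      rw [sub_smul _ _ r, one_smul]
      exact eq_sub_of_add_eq this
    rcases smul_eq_zero.1 h2 with h | h
    · linarith
    · exact hrp (sub_eq_zero.1 h).symm
  · by_contra hrK
    have : z = p := hsingle p fun k hk hkp => hwk k hk hkp (by rintro rfl; exact hrK hk)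
    have h2 : t • (r - p) = 0 := by
      have : (1 - t) • p + t • r = p := this
      rw [sub_smul, one_smul] at this
      rw [smul_sub, sub_eq_zero]
      have h3 : t • r - t • p = 0 := by
        have := sub_eq_zero.2 this
        rw [← this]; abel
      exact sub_eq_zero.1 h3
    rcases smul_eq_zero.1 h2 with h | h
    · linarith
    · exact hrp (sub_eq_zero.1 h)

/-! ### Boxes as polytopes. -/

theorem voronoi_eq_polytope {p : Pt d} :
    T.voronoi p = polytope (T.vertices.erase p) (fun r => midpoint ℝ p r) (fun r => normal p r) := by
  ext x
  constructor
  · intro hx r hr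
    rw [Finset.mem_erase] at hr
    exact (dist_le_dist_iff_inner hr.1.symm).1 (hx r hr.2)
  · intro hx r hr
    by_cases h : r = p
    · rw [h]
    · exact (dist_le_dist_iff_inner (Ne.symm h)).2 (hx r (Finset.mem_erase.2 ⟨h, hr⟩))

theorem isClosed_voronoi (p : Pt d) : IsClosed (T.voronoi p) := by
  have : T.voronoi p = ⋂ r ∈ T.vertices, {x | dist x p ≤ dist x r} := by
    ext x; simp [voronoi]
  rw [this]
  exact isClosed_biInter fun r _ => isClosed_le (by fun_prop) (by fun_prop)

/-- This is where untruncated boxes matter: intersecting with `closure Ω` removes nothing from the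
facet of an interior vertex. -/
theorem facet_eq_face (hbox : T.BoxesInDomain) {p r : Pt d} (hp : p ∈ T.interiorVertices)
    (hr : r ∈ T.vertices.erase p) :
    facet (T.vertices.erase p) (fun r => midpoint ℝ p r) (fun r => normal p r) r = T.face p r := by
  obtain ⟨hrp, hrv⟩ := Finset.mem_erase.1 hr
  have hpv := (mem_interiorVertices.1 hp).1
  have hiff : ∀ x, ⟪x - midpoint ℝ p r, normal p r⟫ = 0 ↔ dist x p = dist x r := by
    intro x
    have h1 := dist_le_dist_iff_inner (x := x) hrp.symm
    have h2 := dist_le_dist_iff_inner (x := x) hrp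
    rw [midpoint_comm, normal_comm, inner_neg_right, neg_nonpos] at h2
    rw [le_antisymm_iff, le_antisymm_iff, ← h1, ← h2]
  rw [facet, ← voronoi_eq_polytope]
  ext x
  simp only [Set.mem_inter_iff, Set.mem_ofPred_eq, hiff, face, cell]
  constructor
  · rintro ⟨hx, he⟩
    exact ⟨⟨hx, hbox p hp hx⟩, fun s hs => he ▸ hx s hs, hbox p hp hx⟩
  · rintro ⟨⟨hx, -⟩, hx', -⟩
    exact ⟨hx, le_antisymm (hx r hrv) (hx' p hpv)⟩

/-- The divergence theorem for constants on a box. -/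
theorem sum_faceArea_smul_normal (hΩ : Bornology.IsBounded Ω) (hbox : T.BoxesInDomain) {p : Pt d}
    (hp : p ∈ T.interiorVertices) : ∑ r ∈ T.nbrs p, T.faceArea p r • normal p r = 0 := by
  have hcpt : IsCompact (T.voronoi p) :=
    hΩ.closure.isCompact_closure.of_isClosed_subset (isClosed_voronoi p)
      ((hbox p hp).trans subset_closure)
  rw [voronoi_eq_polytope] at hcpt
  have h := sum_area_smul_normal hcpt (fun r hr => norm_normal (Finset.mem_erase.1 hr).1.symm) ?_
  · rw [← h]
    -- A vertex outside `T.nbrs p` contributes a facet of area zero.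
    refine Finset.sum_subset_zero_on_sdiff (fun r hr => ?_) (fun r hr => ?_) (fun r hr => ?_)
    · exact Finset.mem_erase.2 ⟨(mem_nbrs.1 hr).2.1, (mem_nbrs.1 hr).1⟩
    · obtain ⟨hr1, hr2⟩ := Finset.mem_sdiff.1 hr
      rw [facet_eq_face hbox hp hr1]
      obtain ⟨hrp, hrv⟩ := Finset.mem_erase.1 hr1
      have : (surface d).real (T.face p r) = 0 := by
        by_contra hne
        exact hr2 (mem_nbrs.2 ⟨hrv, hrp, lt_of_le_of_ne measureReal_nonneg (Ne.symm hne)⟩)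
      rw [this, zero_smul]
    · rw [facet_eq_face hbox hp (Finset.mem_erase.2 ⟨(mem_nbrs.1 hr).2.1, (mem_nbrs.1 hr).1⟩)]
      rfl
  · intro r hr s hs hrs
    rw [facet_eq_face hbox hp hr, facet_eq_face hbox hp hs]
    obtain ⟨hrp, hrv⟩ := Finset.mem_erase.1 hr
    obtain ⟨hsp, hsv⟩ := Finset.mem_erase.1 hs
    have hpv := (mem_interiorVertices.1 hp).1
    refine measure_mono_null ?_ (surface_two_bisectors hrp.symm hsp.symm hrs)
    rintro x ⟨⟨h1, h2⟩, ⟨-, h3⟩⟩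
    exact ⟨le_antisymm (h1.1 r hrv) (h2.1 p hpv), le_antisymm (h1.1 s hsv) (h3.1 p hpv)⟩

/-! ### Sizes -/

theorem isCompact_simplex (K : Finset (Pt d)) : IsCompact (simplex K) :=
  Set.Finite.isCompact_convexHull (𝕜 := ℝ) K.finite_toSet

theorem convex_simplex (K : Finset (Pt d)) : Convex ℝ (simplex K) := convex_convexHull ℝ _

theorem diam_le_meshSize {K : Finset (Pt d)} (hK : K ∈ T.elements) :
    Metric.diam (simplex K) ≤ T.meshSize :=
  le_csSup (T.elements.finite_toSet.image _).bddAbove (Set.mem_image_of_mem _ hK)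

theorem dist_le_meshSize {K : Finset (Pt d)} (hK : K ∈ T.elements) {x y : Pt d}
    (hx : x ∈ simplex K) (hy : y ∈ simplex K) : dist x y ≤ T.meshSize :=
  (Metric.dist_le_diam_of_mem (isCompact_simplex K).isBounded hx hy).trans (diam_le_meshSize hK)

theorem exists_mem_element (hΩ : Ω.Nonempty) : ∃ K, K ∈ T.elements := by
  obtain ⟨x, hx⟩ := hΩ
  have : x ∈ ⋃ K ∈ T.elements, simplex K := T.cover ▸ subset_closure hx
  simp only [Set.mem_iUnion] at this
  obtain ⟨K, hK, -⟩ := this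
  exact ⟨K, hK⟩

theorem exists_mem_simplex {x : Pt d} (hx : x ∈ closure Ω) : ∃ K ∈ T.elements, x ∈ simplex K := by
  rw [← T.cover] at hx
  simpa using hx

theorem meshSize_pos (hd : 0 < d) (hΩ : Ω.Nonempty) : 0 < T.meshSize := by
  obtain ⟨K, hK⟩ := T.exists_mem_element hΩ
  have h1 : 1 < K.card := by rw [T.card_eq K hK]; omega
  obtain ⟨a, ha, b, hb, hab⟩ := Finset.one_lt_card.1 h1
  exact (dist_pos.2 hab).trans_le (dist_le_meshSize hK (subset_simplex ha) (subset_simplex hb))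

theorem vertex_mem_closure {p : Pt d} (hp : p ∈ T.vertices) : p ∈ closure Ω := by
  obtain ⟨K, hK, hpK⟩ := mem_vertices.1 hp
  exact simplex_subset_closure hK (subset_simplex hpK)

/-- `p` is a nearest vertex to `x`, and the element containing `x` already has vertices within `h`.
-/
theorem dist_le_of_mem_cell {p x : Pt d} (hx : x ∈ T.cell p) : dist x p ≤ T.meshSize := by
  obtain ⟨K, hK, hxK⟩ := exists_mem_simplex (T := T) hx.2
  obtain ⟨r, hr⟩ := Finset.card_pos.1 (by rw [T.card_eq K hK]; omega : 0 < K.card)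
  exact (hx.1 r (mem_vertices.2 ⟨K, hK, hr⟩)).trans
    (dist_le_meshSize hK hxK (subset_simplex hr))

/-! ### Elements partition the domain -/

/-- By conformity the intersection is the hull of the common vertices, of which there are at most
`d`; these span too small a space for an interior point. -/
theorem disjoint_interior_simplex {K L : Finset (Pt d)} (hK : K ∈ T.elements)
    (hL : L ∈ T.elements) (hKL : K ≠ L) :
    Disjoint (interior (simplex K)) (interior (simplex L)) := by
  classical
  rw [Set.disjoint_iff_inter_eq_empty, ← interior_inter, T.conforming K hK L hL]
  rw [← Finset.coe_inter]
  by_contra hne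
  have hne' := Set.nonempty_iff_ne_empty.2 hne
  have htop := (interior_convexHull_nonempty_iff_affineSpan_eq_top).1 hne'
  have hcard : (K ∩ L).card < d + 1 := by
    rw [← T.card_eq K hK]
    refine Finset.card_lt_card (lt_of_le_of_ne Finset.inter_subset_left fun h => hKL ?_)
    exact Finset.eq_of_subset_of_card_le (Finset.inter_eq_left.1 h)
      (by rw [T.card_eq K hK, T.card_eq L hL])
  have hpos : 0 < (K ∩ L).card := by
    rw [Finset.card_pos]
    obtain ⟨x, hx⟩ := hne'
    exact Finset.coe_nonempty.1 (convexHull_nonempty_iff.1 ⟨x, interior_subset hx⟩)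
  have h2 := finrank_vectorSpan_image_finset_le ℝ (id : Pt d → Pt d) (K ∩ L)
    (n := (K ∩ L).card - 1) (by omega)
  rw [Finset.image_id, ← direction_affineSpan, htop, AffineSubspace.direction_top, finrank_top,
    finrank_euclideanSpace_fin] at h2
  omega

theorem interior_simplex_ae_eq (K : Finset (Pt d)) :
    interior (simplex K) =ᵐ[volume] simplex K :=
  interior_ae_eq_of_null_frontier ((convex_simplex K).addHaar_frontier volume)

/-- A boundary point of `Ω` cannot be interior to an element, so the boundary lies in the null
frontiers of the elements. -/
theorem closure_ae_eq (hint : interior (closure Ω) = Ω) (T : Triangulation Ω) :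
    Ω =ᵐ[volume] closure Ω := by
  refine Filter.EventuallyLE.antisymm (Filter.Eventually.of_forall fun x hx => subset_closure hx) ?_
  rw [ae_le_set]
  have hsub : closure Ω \ Ω ⊆ ⋃ K ∈ T.elements, frontier (simplex K) := by
    rintro x ⟨hx, hxΩ⟩
    obtain ⟨K, hK, hxK⟩ := exists_mem_simplex (T := T) hx
    refine Set.mem_biUnion hK ⟨subset_closure hxK, fun hxi => hxΩ ?_⟩
    rw [← hint]
    exact interior_mono (simplex_subset_closure hK) hxi
  refine measure_mono_null hsub ((measure_biUnion_null_iff (Finset.countable_toSet _)).2 ?_)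
  exact fun K _ => (convex_simplex K).addHaar_frontier volume

theorem domain_ae_eq_iUnion (hint : interior (closure Ω) = Ω)
    (T : Triangulation Ω) : Ω =ᵐ[volume] ⋃ K ∈ T.elements, interior (simplex K) := by
  refine (closure_ae_eq hint T).trans ?_
  rw [← T.cover]
  refine (Filter.EventuallyEq.countable_bUnion (Finset.countable_toSet T.elements)
    fun K _ => interior_simplex_ae_eq K).symm

theorem setIntegral_eq_sum (hint : interior (closure Ω) = Ω)
    {f : Pt d → ℝ} (hf : ∀ K ∈ T.elements, IntegrableOn f (simplex K)) :
    ∫ x in Ω, f x = ∑ K ∈ T.elements, ∫ x in simplex K, f x := by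
  rw [setIntegral_congr_set (domain_ae_eq_iUnion hint T),
    integral_biUnion_finset _ (fun K _ => isOpen_interior.measurableSet)
      (fun K hK L hL hKL => disjoint_interior_simplex hK hL hKL)
      (fun K hK => (hf K hK).mono_set interior_subset)]
  exact Finset.sum_congr rfl fun K _ => setIntegral_congr_set (interior_simplex_ae_eq K)

/-! ### Consequences of regularity -/

/-- Quasi-uniformity replaces the element diameter, which depends on the cell or face, by the global
mesh size. -/
theorem comparable_bounds {a : ℝ} {n : ℕ} (hreg : T.IsRegular σ δ κ) (hδ : 0 < δ) (hκ : 0 < κ)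
    (hh : 0 ≤ T.meshSize) {K : Finset (Pt d)} (hK : K ∈ T.elements)
    (h : Comparable κ a (Metric.diam (simplex K) ^ n)) :
    κ⁻¹ * (δ * T.meshSize) ^ n ≤ a ∧ a ≤ κ * T.meshSize ^ n := by
  have h0 : 0 ≤ δ * T.meshSize := by positivity
  have h1 := pow_le_pow_left₀ h0 (hreg.quasiUniform K hK) n
  have h2 := pow_le_pow_left₀ Metric.diam_nonneg (diam_le_meshSize hK) n
  exact ⟨(mul_le_mul_of_nonneg_left h1 (inv_nonneg.2 hκ.le)).trans h.1,
    h.2.trans (mul_le_mul_of_nonneg_left h2 hκ.le)⟩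

theorem cellVol_bounds (hreg : T.IsRegular σ δ κ) (hδ : 0 < δ) (hκ : 0 < κ)
    (hh : 0 ≤ T.meshSize) {p : Pt d} (hp : p ∈ T.vertices) :
    κ⁻¹ * (δ * T.meshSize) ^ d ≤ T.cellVol p ∧ T.cellVol p ≤ κ * T.meshSize ^ d := by
  obtain ⟨K, hK, -, h⟩ := hreg.cellVol_comparable p hp
  exact comparable_bounds hreg hδ hκ hh hK h

theorem faceArea_bounds (hreg : T.IsRegular σ δ κ) (hδ : 0 < δ) (hκ : 0 < κ)
    (hh : 0 ≤ T.meshSize) {p r : Pt d} (hp : p ∈ T.vertices) (hr : r ∈ T.nbrs p) :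
    κ⁻¹ * (δ * T.meshSize) ^ (d - 1) ≤ T.faceArea p r ∧
      T.faceArea p r ≤ κ * T.meshSize ^ (d - 1) := by
  obtain ⟨K, hK, -, -, h⟩ := hreg.face_comparable p hp r hr
  exact comparable_bounds hreg hδ hκ hh hK h

theorem dist_nbr_bounds (hreg : T.IsRegular σ δ κ) (hδ : 0 < δ) (hκ : 0 < κ)
    (hh : 0 ≤ T.meshSize) {p r : Pt d} (hp : p ∈ T.vertices) (hr : r ∈ T.nbrs p) :
    κ⁻¹ * (δ * T.meshSize) ≤ dist p r ∧ dist p r ≤ κ * T.meshSize := by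
  obtain ⟨K, hK, -, h, -⟩ := hreg.face_comparable p hp r hr
  have := comparable_bounds (n := 1) hreg hδ hκ hh hK (by rwa [pow_one])
  rwa [pow_one, pow_one] at this

/-- The volume of the unit ball. -/
def unitBallVol (d : ℕ) : ℝ := volume.real (Metric.ball (0 : Pt d) 1)

theorem unitBallVol_pos (d : ℕ) : 0 < unitBallVol d :=
  ENNReal.toReal_pos (Metric.measure_ball_pos _ _ one_pos).ne' measure_ball_lt_top.ne

theorem le_volume_simplex (hreg : T.IsRegular σ δ κ) (hσ : 0 < σ) (hδ : 0 < δ)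
    (hh : 0 < T.meshSize) {K : Finset (Pt d)} (hK : K ∈ T.elements) :
    unitBallVol d * (σ * δ * T.meshSize) ^ d ≤ volume.real (simplex K) := by
  obtain ⟨c, hc⟩ := hreg.shape K hK
  have hq := hreg.quasiUniform K hK
  have hsub : Metric.ball c (σ * δ * T.meshSize) ⊆ simplex K :=
    (Metric.ball_subset_ball (by rw [mul_assoc]; gcongr)).trans hc
  refine le_trans (le_of_eq ?_) (measureReal_mono hsub (isCompact_simplex K).measure_lt_top.ne)
  rw [Measure.real, Measure.addHaar_ball_of_pos _ _ (by positivity), ENNReal.toReal_mul,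
    ENNReal.toReal_ofReal (by positivity), finrank_euclideanSpace_fin, mul_comm]
  rfl

theorem isClosed_cell (p : Pt d) : IsClosed (T.cell p) := (isClosed_voronoi p).inter isClosed_closure

theorem measurableSet_cell (p : Pt d) : MeasurableSet (T.cell p) := (isClosed_cell p).measurableSet

theorem volume_cell_inter {p r : Pt d} (hp : p ∈ T.vertices) (hr : r ∈ T.vertices) (h : p ≠ r) :
    volume (T.cell p ∩ T.cell r) = 0 := by
  refine measure_mono_null (t := (AffineSubspace.perpBisector p r : Set (Pt d))) ?_
    (Measure.addHaar_affineSubspace _ _ (by rwa [Ne, AffineSubspace.perpBisector_eq_top]))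
  rintro x ⟨h1, h2⟩
  rw [SetLike.mem_coe, AffineSubspace.mem_perpBisector_iff_dist_eq]
  exact le_antisymm (h1.1 r hr) (h2.1 p hp)

theorem volume_cell_lt_top (hΩ : Bornology.IsBounded Ω) (p : Pt d) : volume (T.cell p) < ⊤ :=
  (hΩ.closure.subset Set.inter_subset_right).measure_lt_top

/-- A ball of radius comparable to the mesh size contains a bounded number of vertices. -/
theorem card_vertices_near_le (hreg : T.IsRegular σ δ κ) (hδ : 0 < δ) (hκ : 0 < κ)
    (hh : 0 < T.meshSize) (hΩ : Bornology.IsBounded Ω) (x : Pt d) {ρ : ℝ} (hρ : 0 ≤ ρ)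
    {S : Finset (Pt d)} (hS : ∀ p ∈ S, p ∈ T.vertices ∧ dist p x ≤ ρ * T.meshSize) :
    (S.card : ℝ) ≤ κ * (ρ + 1) ^ d * unitBallVol d / δ ^ d := by
  -- Volume packing: the cells overlap in null sets, each has volume at least `κ⁻¹ (δ h)^d`, and
  -- each reaches at most `h` beyond its vertex, whence the radius `ρ + 1`.
  have hsub : (⋃ p ∈ S, T.cell p) ⊆ Metric.closedBall x ((ρ + 1) * T.meshSize) := by
    refine Set.iUnion₂_subset fun p hp y hy => ?_
    rw [Metric.mem_closedBall]
    have h1 := dist_triangle y p x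
    have h2 := dist_le_of_mem_cell hy
    have h3 := (hS p hp).2
    linarith
  have hvol : ∑ p ∈ S, T.cellVol p ≤ volume.real (Metric.closedBall x ((ρ + 1) * T.meshSize)) := by
    have h1 : volume (⋃ p ∈ S, T.cell p) = ∑ p ∈ S, volume (T.cell p) :=
      measure_biUnion_finset₀
        (fun p hp r hr hpr => volume_cell_inter (hS p hp).1 (hS r hr).1 hpr)
        (fun p _ => (measurableSet_cell p).nullMeasurableSet)
    have h2 := measure_mono (μ := volume) hsub
    rw [h1] at h2
    have h3 := ENNReal.toReal_mono measure_closedBall_lt_top.ne h2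
    rwa [ENNReal.toReal_sum fun p _ => (volume_cell_lt_top hΩ p).ne] at h3
  have hlow : (S.card : ℝ) * (κ⁻¹ * (δ * T.meshSize) ^ d) ≤ ∑ p ∈ S, T.cellVol p := by
    rw [← nsmul_eq_mul]
    exact Finset.card_nsmul_le_sum _ _ _ fun p hp => (cellVol_bounds hreg hδ hκ hh.le (hS p hp).1).1
  have hball : volume.real (Metric.closedBall x ((ρ + 1) * T.meshSize)) =
      ((ρ + 1) * T.meshSize) ^ d * unitBallVol d := by
    rw [Measure.real, Measure.addHaar_closedBall _ _ (by positivity), ENNReal.toReal_mul,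
      ENNReal.toReal_ofReal (by positivity), finrank_euclideanSpace_fin]
    rfl
  have h := hlow.trans (hvol.trans_eq hball)
  rw [le_div_iff₀ (by positivity)]
  rw [mul_pow, mul_pow] at h
  have hpos : 0 < T.meshSize ^ d := by positivity
  refine le_of_mul_le_mul_right ?_ hpos
  calc (S.card : ℝ) * δ ^ d * T.meshSize ^ d
      = κ * ((S.card : ℝ) * (κ⁻¹ * (δ ^ d * T.meshSize ^ d))) := by field_simp
    _ ≤ κ * ((ρ + 1) ^ d * T.meshSize ^ d * unitBallVol d) := by gcongr
    _ = κ * (ρ + 1) ^ d * unitBallVol d * T.meshSize ^ d := by ring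

/-! ### Gradients of piecewise linear functions -/

/-- The norm of the gradient of a piecewise linear function on an element. -/
def slope (q : Pt d → ℝ) (K : Finset (Pt d)) : ℝ :=
  open Classical in
  if h : ∃ A : Pt d →ᵃ[ℝ] ℝ, Set.EqOn q A (simplex K) then
    ‖LinearMap.toContinuousLinearMap h.choose.linear‖ else 0

theorem slope_nonneg (q : Pt d → ℝ) (K : Finset (Pt d)) : 0 ≤ slope q K := by
  unfold slope
  split_ifs
  · exact norm_nonneg _
  · exact le_rfl

/-- Returns the very affine map chosen in `slope`, so its uniqueness never has to be discussed. -/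
theorem exists_affine {q : Pt d → ℝ} (hq : q ∈ T.P1) {K : Finset (Pt d)} (hK : K ∈ T.elements) :
    ∃ A : Pt d →ᵃ[ℝ] ℝ, Set.EqOn q A (simplex K) ∧
      slope q K = ‖LinearMap.toContinuousLinearMap A.linear‖ := by
  have h := hq.2 K hK
  refine ⟨h.choose, h.choose_spec, ?_⟩
  rw [slope, dif_pos h]

theorem abs_sub_le_slope {q : Pt d → ℝ} (hq : q ∈ T.P1) {K : Finset (Pt d)} (hK : K ∈ T.elements)
    {x y : Pt d} (hx : x ∈ simplex K) (hy : y ∈ simplex K) :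
    |q x - q y| ≤ slope q K * dist x y := by
  obtain ⟨A, hA, hs⟩ := exists_affine hq hK
  rw [hA hx, hA hy, hs, dist_eq_norm, ← vsub_eq_sub (A x), ← A.linearMap_vsub]
  exact (LinearMap.toContinuousLinearMap A.linear).le_opNorm _

theorem norm_fderiv_eq_slope {q : Pt d → ℝ} (hq : q ∈ T.P1) {K : Finset (Pt d)}
    (hK : K ∈ T.elements) {x : Pt d} (hx : x ∈ interior (simplex K)) :
    ‖fderiv ℝ q x‖ = slope q K := by
  obtain ⟨A, hA, hs⟩ := exists_affine hq hK
  have h1 : q =ᶠ[nhds x] A := hA.eventuallyEq_of_mem (mem_interior_iff_mem_nhds.1 hx)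
  rw [h1.fderiv_eq, hs]
  have h2 : HasFDerivAt A (LinearMap.toContinuousLinearMap A.linear) x := by
    have h3 : (A : Pt d → ℝ) = fun y => LinearMap.toContinuousLinearMap A.linear y + A 0 := by
      ext y
      rw [A.decomp]
      simp
    rw [h3]
    exact (ContinuousLinearMap.hasFDerivAt _).add_const _
  rw [h2.fderiv]

theorem seminormH1_sq (hint : interior (closure Ω) = Ω) {q : Pt d → ℝ} (hq : q ∈ T.P1) :
    seminormH1 Ω q ^ 2 = ∑ K ∈ T.elements, volume.real (simplex K) * slope q K ^ 2 := by
  rw [seminormH1, Real.sq_sqrt (integral_nonneg fun x => sq_nonneg _)]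
  have hae : ∀ K ∈ T.elements, ∀ᵐ x ∂(volume.restrict (simplex K)),
      ‖fderiv ℝ q x‖ ^ 2 = slope q K ^ 2 := by
    intro K hK
    rw [← Measure.restrict_congr_set (interior_simplex_ae_eq K)]
    refine (ae_restrict_iff' isOpen_interior.measurableSet).2 (Filter.Eventually.of_forall ?_)
    intro x hx
    rw [norm_fderiv_eq_slope hq hK hx]
  rw [setIntegral_eq_sum (T := T) hint]
  · refine Finset.sum_congr rfl fun K hK => ?_
    rw [integral_congr_ae (hae K hK), setIntegral_const, smul_eq_mul]
  · intro K hK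
    have : IntegrableOn (fun _ => slope q K ^ 2) (simplex K) volume :=
      integrableOn_const (isCompact_simplex K).measure_lt_top.ne
    exact this.congr ((hae K hK).mono fun x hx => hx.symm)

/-- The discrete form of the `H¹` seminorm. -/
theorem sum_slope_sq_le (hreg : T.IsRegular σ δ κ) (hσ : 0 < σ) (hδ : 0 < δ)
    (hh : 0 < T.meshSize) (hint : interior (closure Ω) = Ω) {q : Pt d → ℝ} (hq : q ∈ T.P1) :
    unitBallVol d * (σ * δ) ^ d * (T.meshSize ^ d * ∑ K ∈ T.elements, slope q K ^ 2)
      ≤ seminormH1 Ω q ^ 2 := by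
  rw [seminormH1_sq hint hq, Finset.mul_sum, Finset.mul_sum]
  refine Finset.sum_le_sum fun K hK => ?_
  calc _ = unitBallVol d * (σ * δ * T.meshSize) ^ d * slope q K ^ 2 := by rw [mul_pow]; ring
    _ ≤ _ := mul_le_mul_of_nonneg_right (le_volume_simplex hreg hσ hδ hh hK) (sq_nonneg _)

/-! ### Vertex values -/

/-- Contract the simplex towards `p` by the factor `1/2`. Since `A p = 2 A (φ x) - A x`, the vertex
value is controlled by two integrals of `A ^ 2`. The one over the contracted simplex costs the
Jacobian `2 ^ d`, which explains `8 * 2 ^ d + 2`. -/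
theorem volume_mul_sq_le {K : Finset (Pt d)} (A : Pt d →ᵃ[ℝ] ℝ) {p : Pt d} (hp : p ∈ simplex K) :
    volume.real (simplex K) * A p ^ 2 ≤ (8 * 2 ^ d + 2) * ∫ x in simplex K, A x ^ 2 := by
  have hAc : Continuous A := A.continuous_of_finiteDimensional
  have hcpt := isCompact_simplex K
  let φ : Pt d → Pt d := fun x => (2⁻¹ : ℝ) • p + (2⁻¹ : ℝ) • x
  have hφc : Continuous φ := by fun_prop
  have hφS : φ '' simplex K ⊆ simplex K := by
    rintro _ ⟨x, hx, rfl⟩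
    exact convex_simplex K hp hx (by norm_num) (by norm_num) (by norm_num)
  have hAφ : ∀ x, A (φ x) = 2⁻¹ * A p + 2⁻¹ * A x := by
    intro x
    have := Convex.combo_affine_apply (f := A) (x := p) (y := x)
      (show (2⁻¹ : ℝ) + 2⁻¹ = 1 by norm_num)
    simpa using this
  have hcv : ∫ x in φ '' simplex K, A x ^ 2 = ∫ x in simplex K, (2⁻¹ : ℝ) ^ d * A (φ x) ^ 2 := by
    have hd : ∀ x ∈ simplex K, HasFDerivWithinAt φ
        ((2⁻¹ : ℝ) • ContinuousLinearMap.id ℝ (Pt d)) (simplex K) x := by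
      intro x _
      exact (((hasFDerivAt_id x).const_smul (2⁻¹ : ℝ)).const_add _).hasFDerivWithinAt
    have hinj : Set.InjOn φ (simplex K) := by
      intro x _ y _ hxy
      have : (2⁻¹ : ℝ) • x = (2⁻¹ : ℝ) • y := add_left_cancel hxy
      exact smul_right_injective _ (by norm_num : (2⁻¹ : ℝ) ≠ 0) this
    rw [integral_image_eq_integral_abs_det_fderiv_smul volume hcpt.measurableSet hd hinj]
    have hdet : |((2⁻¹ : ℝ) • ContinuousLinearMap.id ℝ (Pt d)).det| = (2⁻¹ : ℝ) ^ d := by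
      rw [ContinuousLinearMap.det]
      simp [LinearMap.det_smul, abs_of_pos]
    rw [hdet]
    rfl
  have hint : ∀ f : Pt d → ℝ, Continuous f → IntegrableOn f (simplex K) volume := fun f hf =>
    hf.continuousOn.integrableOn_compact hcpt
  have hmono : ∫ x in φ '' simplex K, A x ^ 2 ≤ ∫ x in simplex K, A x ^ 2 :=
    setIntegral_mono_set (hint _ (by fun_prop)) (ae_of_all _ fun x => sq_nonneg _)
      hφS.eventuallyLE
  rw [hcv, integral_const_mul] at hmono
  have hcomp : ∫ x in simplex K, A (φ x) ^ 2 ≤ 2 ^ d * ∫ x in simplex K, A x ^ 2 := by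
    calc ∫ x in simplex K, A (φ x) ^ 2
        = 2 ^ d * ((2⁻¹ : ℝ) ^ d * ∫ x in simplex K, A (φ x) ^ 2) := by
          rw [← mul_assoc, ← mul_pow]; norm_num
      _ ≤ _ := by gcongr
  have hpt : ∀ x, A p ^ 2 ≤ 8 * A (φ x) ^ 2 + 2 * A x ^ 2 := by
    intro x
    rw [hAφ]
    nlinarith [sq_nonneg (A p + 2 * A x)]
  calc volume.real (simplex K) * A p ^ 2 = ∫ _ in simplex K, A p ^ 2 := by
        rw [setIntegral_const, smul_eq_mul]
    _ ≤ ∫ x in simplex K, (8 * A (φ x) ^ 2 + 2 * A x ^ 2) :=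
        integral_mono (hint _ continuous_const) (hint _ (by fun_prop)) hpt
    _ = 8 * (∫ x in simplex K, A (φ x) ^ 2) + 2 * ∫ x in simplex K, A x ^ 2 := by
        rw [integral_add (hint _ (by fun_prop)) (hint _ (by fun_prop)), integral_const_mul,
          integral_const_mul]
    _ ≤ _ := by linarith

theorem normL2_sq (hint : interior (closure Ω) = Ω) {q : Pt d → ℝ} (hq : q ∈ T.P1) :
    normL2 Ω q ^ 2 = ∑ K ∈ T.elements, ∫ x in simplex K, q x ^ 2 := by
  rw [normL2, Real.sq_sqrt (integral_nonneg fun x => sq_nonneg _),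
    setIntegral_eq_sum (T := T) hint]
  exact fun K hK => ((hq.1.mono (simplex_subset_closure hK)).pow 2).integrableOn_compact
    (isCompact_simplex K)

/-- Vertex values are controlled by the `L²` norm. -/
theorem sum_vertex_sq_le (hreg : T.IsRegular σ δ κ) (hσ : 0 < σ) (hδ : 0 < δ)
    (hh : 0 < T.meshSize) (hint : interior (closure Ω) = Ω) {q : Pt d → ℝ} (hq : q ∈ T.P1) :
    unitBallVol d * (σ * δ) ^ d * (T.meshSize ^ d * ∑ p ∈ T.vertices, q p ^ 2)
      ≤ (d + 1) * (8 * 2 ^ d + 2) * normL2 Ω q ^ 2 := by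
  have hU := unitBallVol_pos d
  have h1 : ∑ p ∈ T.vertices, q p ^ 2 ≤ ∑ K ∈ T.elements, ∑ p ∈ K, q p ^ 2 := by
    classical
    have hcomm : ∑ K ∈ T.elements, ∑ p ∈ K, q p ^ 2 =
        ∑ p ∈ T.vertices, ∑ _K ∈ T.elements.filter (fun K => p ∈ K), q p ^ 2 :=
      Finset.sum_comm' fun K p => by
        simp only [Finset.mem_filter, mem_vertices]
        exact ⟨fun h => ⟨h, K, h⟩, fun h => h.1⟩
    rw [hcomm]
    refine Finset.sum_le_sum fun p hp => ?_
    obtain ⟨K, hK, hpK⟩ := mem_vertices.1 hp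
    exact Finset.single_le_sum (f := fun _ => q p ^ 2) (fun _ _ => sq_nonneg _)
      (Finset.mem_filter.2 ⟨hK, hpK⟩)
  have h2 : ∀ K ∈ T.elements, unitBallVol d * (σ * δ) ^ d * (T.meshSize ^ d * ∑ p ∈ K, q p ^ 2)
      ≤ (d + 1) * (8 * 2 ^ d + 2) * ∫ x in simplex K, q x ^ 2 := by
    intro K hK
    obtain ⟨A, hA, -⟩ := exists_affine hq hK
    have hI : ∫ x in simplex K, q x ^ 2 = ∫ x in simplex K, A x ^ 2 :=
      setIntegral_congr_fun (isCompact_simplex K).measurableSet fun x hx => by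
        simp only [hA hx]
    calc _ = ∑ p ∈ K, unitBallVol d * (σ * δ * T.meshSize) ^ d * q p ^ 2 := by
          rw [← Finset.mul_sum, mul_pow]; ring
      _ ≤ ∑ p ∈ K, (8 * 2 ^ d + 2) * ∫ x in simplex K, A x ^ 2 := by
          refine Finset.sum_le_sum fun p hp => ?_
          rw [hA (subset_simplex hp)]
          exact (mul_le_mul_of_nonneg_right (le_volume_simplex hreg hσ hδ hh hK)
            (sq_nonneg _)).trans (volume_mul_sq_le A (subset_simplex hp))
      _ = _ := by rw [Finset.sum_const, T.card_eq K hK, hI, nsmul_eq_mul]; push_cast; ring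
  calc _ ≤ unitBallVol d * (σ * δ) ^ d * (T.meshSize ^ d * ∑ K ∈ T.elements, ∑ p ∈ K, q p ^ 2) := by
        gcongr
    _ = ∑ K ∈ T.elements, unitBallVol d * (σ * δ) ^ d * (T.meshSize ^ d * ∑ p ∈ K, q p ^ 2) := by
        rw [Finset.mul_sum, Finset.mul_sum]
    _ ≤ _ := (Finset.sum_le_sum h2).trans_eq (by rw [normL2_sq hint hq, Finset.mul_sum])

/-- The `L²` norm of a lumped function. -/
theorem normL2_boxFun_sq (hΩ : Bornology.IsBounded Ω) (hint : interior (closure Ω) = Ω)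
    (c : Pt d → ℝ) :
    normL2 Ω (T.boxFun c) ^ 2 = ∑ p ∈ T.interiorVertices, T.cellVol p * c p ^ 2 := by
  rw [normL2, Real.sq_sqrt (integral_nonneg fun x => sq_nonneg _)]
  -- Off the overlaps of the cells at most one indicator is nonzero, so the square of the sum is the
  -- sum of the squares.
  have hnull : volume (⋃ p ∈ T.interiorVertices, ⋃ r ∈ T.interiorVertices.erase p,
      T.cell p ∩ T.cell r) = 0 := by
    refine (measure_biUnion_null_iff (Finset.countable_toSet _)).2 fun p hp => ?_
    refine (measure_biUnion_null_iff (Finset.countable_toSet _)).2 fun r hr => ?_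
    obtain ⟨hrp, hr⟩ := Finset.mem_erase.1 (Finset.mem_coe.1 hr)
    exact volume_cell_inter (mem_interiorVertices.1 hp).1 (mem_interiorVertices.1 hr).1 hrp.symm
  have hae : ∀ᵐ x ∂(volume.restrict Ω), T.boxFun c x ^ 2 =
      ∑ p ∈ T.interiorVertices, (T.cell p).indicator (fun _ => c p ^ 2) x := by
    refine ae_restrict_of_ae ?_
    filter_upwards [measure_eq_zero_iff_ae_notMem.1 hnull] with x hx
    simp only [Set.mem_iUnion, not_exists] at hx
    by_cases hex : ∃ p ∈ T.interiorVertices, x ∈ T.cell p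
    · obtain ⟨p, hp, hxp⟩ := hex
      have hnot : ∀ r ∈ T.interiorVertices, r ≠ p → x ∉ T.cell r := fun r hr hrp hxr =>
        hx p hp r (Finset.mem_erase.2 ⟨hrp, hr⟩) ⟨hxp, hxr⟩
      rw [boxFun, Finset.sum_eq_single_of_mem p hp, Finset.sum_eq_single_of_mem p hp,
        Set.indicator_of_mem hxp, Set.indicator_of_mem hxp]
      · exact fun r hr hrp => Set.indicator_of_notMem (hnot r hr hrp) _
      · exact fun r hr hrp => Set.indicator_of_notMem (hnot r hr hrp) _
    · push Not at hex
      rw [boxFun, Finset.sum_eq_zero, Finset.sum_eq_zero, zero_pow two_ne_zero]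
      · exact fun r hr => Set.indicator_of_notMem (hex r hr) _
      · exact fun r hr => Set.indicator_of_notMem (hex r hr) _
  rw [integral_congr_ae hae, setIntegral_congr_set (closure_ae_eq hint T), integral_finsetSum]
  · refine Finset.sum_congr rfl fun p _ => ?_
    rw [integral_indicator (measurableSet_cell p), Measure.restrict_restrict (measurableSet_cell p),
      Set.inter_eq_self_of_subset_left (show T.cell p ⊆ closure Ω from Set.inter_subset_right),
      setIntegral_const, smul_eq_mul]
    rfl
  · intro p _
    rw [integrable_indicator_iff (measurableSet_cell p)]
    refine integrableOn_const ?_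
    rw [Measure.restrict_apply (measurableSet_cell p)]
    exact ((measure_mono Set.inter_subset_left).trans_lt (volume_cell_lt_top hΩ p)).ne

end Triangulation

/-! ### Directional derivatives of piecewise linear functions within the closed domain. -/

section DirectionalDerivative

open Filter Topology

theorem lineDerivWithin_neg {d : ℕ} (q : Pt d → ℝ) (S : Set (Pt d)) (x v : Pt d) :
    lineDerivWithin ℝ q S x (-v) = -lineDerivWithin ℝ q S x v := by
  unfold lineDerivWithin
  have h := derivWithin_comp_neg (f := fun t : ℝ => q (x + t • v))
    (s := (fun t : ℝ => x + t • (-v)) ⁻¹' S) (x := 0)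
  simp only [neg_smul, smul_neg, neg_zero] at h ⊢
  rw [h]
  congr 2
  ext t
  simp

/-- The points from which the direction `v` points into the simplex `K`. -/
def dirSet {d : ℕ} (K : Finset (Pt d)) (v : Pt d) : Set (Pt d) :=
  {x | ∃ᶠ t : ℝ in 𝓝[>] 0, x + t • v ∈ simplex K}

theorem tendsto_line {d : ℕ} (x v : Pt d) : Tendsto (fun t : ℝ => x + t • v) (𝓝[>] 0) (𝓝 x) := by
  have hc : Continuous fun t : ℝ => x + t • v := by fun_prop
  have := hc.tendsto 0
  simp only [zero_smul, add_zero] at this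
  exact this.mono_left nhdsWithin_le_nhds

theorem mem_simplex_of_mem_dirSet {d : ℕ} {K : Finset (Pt d)} {v x : Pt d} (hx : x ∈ dirSet K v) :
    x ∈ simplex K :=
  (isCompact_simplex K).isClosed.mem_of_frequently_of_tendsto hx (tendsto_line x v)

theorem segment_subset_simplex {d : ℕ} {K : Finset (Pt d)} {v x : Pt d} (hx : x ∈ simplex K)
    {s t : ℝ} (h0 : 0 ≤ t) (hts : t ≤ s) (hs : x + s • v ∈ simplex K) :
    x + t • v ∈ simplex K := by
  rcases hts.eq_or_lt with rfl | hlt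
  · exact hs
  have hspos : 0 < s := h0.trans_lt hlt
  have := (convex_simplex K).add_smul_mem hx hs (t := t / s)
    ⟨by positivity, (div_le_one hspos).2 hts⟩
  rwa [smul_smul, div_mul_cancel₀ _ hspos.ne'] at this

theorem exists_pos_of_mem_dirSet {d : ℕ} {K : Finset (Pt d)} {v x : Pt d} (hx : x ∈ dirSet K v) :
    ∃ s : ℝ, 0 < s ∧ ∀ t ∈ Set.Icc 0 s, x + t • v ∈ simplex K := by
  obtain ⟨s, hs, hpos⟩ := (Filter.Frequently.and_eventually hx self_mem_nhdsWithin).exists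
  exact ⟨s, hpos, fun t ht =>
    segment_subset_simplex (mem_simplex_of_mem_dirSet hx) ht.1 ht.2 hs⟩

/-- Convexity turns frequent membership into membership for all small `t > 0`. -/
theorem eventually_mem_simplex_iff {d : ℕ} (K : Finset (Pt d)) (v x : Pt d) :
    ∀ᶠ t : ℝ in 𝓝[>] 0, x + t • v ∈ simplex K ↔ x ∈ dirSet K v := by
  by_cases hx : x ∈ dirSet K v
  · obtain ⟨s, hs, h⟩ := exists_pos_of_mem_dirSet hx
    filter_upwards [Ioc_mem_nhdsGT hs] with t ht
    exact iff_of_true (h t ⟨ht.1.le, ht.2⟩) hx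
  · filter_upwards [not_frequently.1 hx] with t ht
    exact iff_of_false ht hx

/-- By convexity it suffices that `x` and one point `x + (m + 1)⁻¹ • v` lie in the simplex, which
leaves a countable union of closed sets. -/
theorem measurableSet_dirSet {d : ℕ} (K : Finset (Pt d)) (v : Pt d) :
    MeasurableSet (dirSet K v) := by
  have : dirSet K v = ⋃ m : ℕ, simplex K ∩ (fun x => x + ((m : ℝ) + 1)⁻¹ • v) ⁻¹' simplex K := by
    ext x
    simp only [Set.mem_iUnion, Set.mem_inter_iff, Set.mem_preimage]
    constructor
    · intro hx
      obtain ⟨s, hs, h⟩ := exists_pos_of_mem_dirSet hx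
      obtain ⟨m, hm⟩ := exists_nat_one_div_lt hs
      rw [one_div] at hm
      exact ⟨m, mem_simplex_of_mem_dirSet hx, h _ ⟨by positivity, hm.le⟩⟩
    · rintro ⟨m, hx, hm⟩
      have hpos : (0 : ℝ) < ((m : ℝ) + 1)⁻¹ := by positivity
      refine Eventually.frequently ?_
      filter_upwards [Ioc_mem_nhdsGT hpos] with t ht
      exact segment_subset_simplex hx ht.1.le ht.2 hm
  rw [this]
  refine MeasurableSet.iUnion fun m => ((isCompact_simplex K).isClosed.inter
    ((isCompact_simplex K).isClosed.preimage (by fun_prop))).measurableSet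

namespace Triangulation

variable {d : ℕ} {Ω : Set (Pt d)} {T : Triangulation Ω} {σ δ κ : ℝ}

theorem eventually_mem_closure_iff (T : Triangulation Ω) (v x : Pt d) :
    ∀ᶠ t : ℝ in 𝓝[>] 0, x + t • v ∈ closure Ω ↔ ∃ K ∈ T.elements, x ∈ dirSet K v := by
  have h : ∀ᶠ t : ℝ in 𝓝[>] 0, ∀ K ∈ T.elements, (x + t • v ∈ simplex K ↔ x ∈ dirSet K v) :=
    (eventually_all_finset _).2 fun K _ => eventually_mem_simplex_iff K v x
  filter_upwards [h] with t ht
  rw [← T.cover]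
  simp only [Set.mem_iUnion, exists_prop]
  exact exists_congr fun K => and_congr_right fun hK => ht K hK

theorem lineDeriv_bound_of_mem_dirSet {q : Pt d → ℝ} (hq : q ∈ T.P1) {K : Finset (Pt d)}
    (hK : K ∈ T.elements) {x v : Pt d} (hv : ‖v‖ ≤ 1) (hx : x ∈ dirSet K v) :
    |lineDerivWithin ℝ q (closure Ω) x v| ≤ slope q K := by
  -- Without differentiability the derivative has the default value `0`. Otherwise it can be
  -- computed along the short segment inside `K`, where `q` is affine.
  by_cases hdiff : LineDifferentiableWithinAt ℝ q (closure Ω) x v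
  swap
  · rw [lineDerivWithin_zero_of_not_lineDifferentiableWithinAt hdiff, abs_zero]
    exact slope_nonneg q K
  obtain ⟨A, hA, hs⟩ := exists_affine hq hK
  obtain ⟨s, hspos, hseg⟩ := exists_pos_of_mem_dirSet hx
  have h1 : HasDerivWithinAt (fun t : ℝ => q (x + t • v)) (lineDerivWithin ℝ q (closure Ω) x v)
      (Set.Icc 0 s) 0 :=
    HasDerivWithinAt.mono hdiff.hasLineDerivWithinAt
      fun t ht => simplex_subset_closure hK (hseg t ht)
  have hlin : ∀ t : ℝ, A (x + t • v) = A x + t * A.linear v := by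
    intro t
    have := A.map_vadd x (t • v)
    rw [vadd_eq_add, vadd_eq_add, add_comm, map_smul, smul_eq_mul] at this
    rw [this, add_comm]
  have h2 : HasDerivWithinAt (fun t : ℝ => q (x + t • v)) (A.linear v) (Set.Icc 0 s) 0 := by
    have h3 : HasDerivWithinAt (fun t : ℝ => A x + t * A.linear v) (A.linear v)
        (Set.Icc 0 s) 0 := by
      simpa using (((hasDerivAt_id (0 : ℝ)).mul_const (A.linear v)).const_add (A x)).hasDerivWithinAt
    exact h3.congr (fun t ht => by rw [hA (hseg t ht), hlin])
      (by rw [hA (hseg 0 ⟨le_rfl, hspos.le⟩), hlin])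
  have hu : UniqueDiffWithinAt ℝ (Set.Icc 0 s) 0 := uniqueDiffOn_Icc hspos 0 ⟨le_rfl, hspos.le⟩
  rw [hu.eq_deriv _ h1 h2, hs]
  have := (LinearMap.toContinuousLinearMap A.linear).le_opNorm v
  exact this.trans (mul_le_of_le_one_right (norm_nonneg _) hv)

open Classical in
/-- Directional derivatives along faces are controlled by the gradients of the elements. -/
theorem abs_lineDerivWithin_le {q : Pt d → ℝ} (hq : q ∈ T.P1) {x v : Pt d} (hv : ‖v‖ ≤ 1) :
    |lineDerivWithin ℝ q (closure Ω) x v| ≤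
      ∑ K ∈ T.elements.filter (fun K => x ∈ simplex K), slope q K := by
  have hle : ∀ K ∈ T.elements, x ∈ simplex K →
      slope q K ≤ ∑ K ∈ T.elements.filter (fun K => x ∈ simplex K), slope q K := fun K hK hx =>
    Finset.single_le_sum (f := slope q) (fun _ _ => slope_nonneg _ _) (Finset.mem_filter.2 ⟨hK, hx⟩)
  by_cases h1 : ∃ K ∈ T.elements, x ∈ dirSet K v
  · obtain ⟨K, hK, hx⟩ := h1
    exact (lineDeriv_bound_of_mem_dirSet hq hK hv hx).trans
      (hle K hK (mem_simplex_of_mem_dirSet hx))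
  by_cases h2 : ∃ K ∈ T.elements, x ∈ dirSet K (-v)
  · obtain ⟨K, hK, hx⟩ := h2
    rw [← abs_neg, ← lineDerivWithin_neg]
    exact (lineDeriv_bound_of_mem_dirSet hq hK (by rwa [norm_neg]) hx).trans
      (hle K hK (mem_simplex_of_mem_dirSet hx))
  -- If neither direction enters an element, the line meets the closed domain near `x` at most in
  -- `x`, and the derivative within it is `0` by convention.
  have hzero : lineDerivWithin ℝ q (closure Ω) x v = 0 := by
    unfold lineDerivWithin
    have he : ((fun t : ℝ => x + t • v) ⁻¹' closure Ω) =ᶠ[𝓝[{0}ᶜ] 0] (∅ : Set ℝ) := by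
      have hr : ∀ᶠ t : ℝ in 𝓝[>] 0, x + t • v ∉ closure Ω := by
        filter_upwards [T.eventually_mem_closure_iff v x] with t ht
        rwa [ht]
      have hl : ∀ᶠ t : ℝ in 𝓝[<] 0, x + t • v ∉ closure Ω := by
        have h3 : ∀ᶠ t : ℝ in 𝓝[>] (-0), x + t • (-v) ∉ closure Ω := by
          rw [neg_zero]
          filter_upwards [T.eventually_mem_closure_iff (-v) x] with t ht
          rwa [ht]
        filter_upwards [tendsto_neg_nhdsLT.eventually h3] with t ht
        simpa using ht
      rw [← Set.Iio_union_Ioi, nhdsWithin_union]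
      exact Filter.eventuallyEq_set.2 (eventually_sup.2
        ⟨hl.mono fun t ht => by simpa using ht, hr.mono fun t ht => by simpa using ht⟩)
    rw [derivWithin_congr_set' 0 he]
    exact derivWithin_zero_of_notMem_closure (by simp)
  rw [hzero, abs_zero]
  exact Finset.sum_nonneg fun _ _ => slope_nonneg _ _

theorem eventually_line_congr {q : Pt d → ℝ} (hq : q ∈ T.P1) {x y v : Pt d}
    (h : ∀ K ∈ T.elements, x ∈ dirSet K v ↔ y ∈ dirSet K v) :
    ∀ᶠ t : ℝ in 𝓝[>] 0, (x + t • v ∈ closure Ω ↔ y + t • v ∈ closure Ω) ∧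
      (y + t • v ∈ closure Ω → q (x + t • v) - q x = q (y + t • v) - q y) := by
  have h1 : ∀ᶠ t : ℝ in 𝓝[>] 0, ∀ K ∈ T.elements, (x + t • v ∈ simplex K ↔ x ∈ dirSet K v) :=
    (eventually_all_finset _).2 fun K _ => eventually_mem_simplex_iff K v x
  have h2 : ∀ᶠ t : ℝ in 𝓝[>] 0, ∀ K ∈ T.elements, (y + t • v ∈ simplex K ↔ y ∈ dirSet K v) :=
    (eventually_all_finset _).2 fun K _ => eventually_mem_simplex_iff K v y
  filter_upwards [h1, h2, T.eventually_mem_closure_iff v x, T.eventually_mem_closure_iff v y]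
    with t g1 g2 g3 g4
  constructor
  · rw [g3, g4]
    exact exists_congr fun K => and_congr_right fun hK => h K hK
  · intro hy
    obtain ⟨K, hK, hyK⟩ := g4.1 hy
    have hxK := (h K hK).2 hyK
    obtain ⟨A, hA, -⟩ := exists_affine hq hK
    have hlin : ∀ z : Pt d, A (z + t • v) - A z = A.linear (t • v) := by
      intro z
      have := A.map_vadd z (t • v)
      rw [vadd_eq_add, vadd_eq_add, add_comm] at this
      rw [this]; ring
    rw [hA ((g1 K hK).2 hxK), hA ((g2 K hK).2 hyK), hA (mem_simplex_of_mem_dirSet hxK),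
      hA (mem_simplex_of_mem_dirSet hyK), hlin, hlin]

/-- The elements entered along `v` and `-v` determine the increments of `q` on the line near the
base point, and hence the derivative. -/
theorem lineDerivWithin_congr_of_dirSet {q : Pt d → ℝ} (hq : q ∈ T.P1) {x y v : Pt d}
    (h : ∀ K ∈ T.elements, x ∈ dirSet K v ↔ y ∈ dirSet K v)
    (h' : ∀ K ∈ T.elements, x ∈ dirSet K (-v) ↔ y ∈ dirSet K (-v)) :
    lineDerivWithin ℝ q (closure Ω) x v = lineDerivWithin ℝ q (closure Ω) y v := by
  have hev : ∀ᶠ t : ℝ in 𝓝[{0}ᶜ] 0, (x + t • v ∈ closure Ω ↔ y + t • v ∈ closure Ω) ∧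
      (y + t • v ∈ closure Ω → q (x + t • v) - q x = q (y + t • v) - q y) := by
    rw [← Set.Iio_union_Ioi, nhdsWithin_union]
    refine eventually_sup.2 ⟨?_, eventually_line_congr hq h⟩
    have h3 := eventually_line_congr hq h'
    rw [← neg_zero] at h3
    filter_upwards [tendsto_neg_nhdsLT.eventually h3] with t ht
    simpa using ht
  unfold lineDerivWithin
  have hset : ((fun t : ℝ => x + t • v) ⁻¹' closure Ω) =ᶠ[𝓝[{0}ᶜ] 0]
      ((fun t : ℝ => y + t • v) ⁻¹' closure Ω) :=
    Filter.eventuallyEq_set.2 (hev.mono fun t ht => ht.1)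
  rw [derivWithin_congr_set' 0 hset]
  have hfun : (fun t : ℝ => q (x + t • v)) =ᶠ[𝓝[(fun t : ℝ => y + t • v) ⁻¹' closure Ω] 0]
      fun t => q (y + t • v) + (q x - q y) := by
    have hall : ∀ᶠ t : ℝ in 𝓝 0,
        y + t • v ∈ closure Ω → q (x + t • v) = q (y + t • v) + (q x - q y) := by
      have h4 := eventually_nhdsWithin_iff.1 hev
      filter_upwards [h4] with t ht hy
      by_cases h0 : t = 0
      · simp [h0]
      · linarith [(ht h0).2 hy]
    exact eventually_nhdsWithin_iff.2 hall
  rw [hfun.derivWithin_eq (by simp), derivWithin_add_const]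

/-- The derivative factors through the finite pattern of memberships in the sets `dirSet`, and each
of these is measurable. Integrability on faces needs this. -/
theorem measurable_lineDerivWithin {q : Pt d → ℝ} (hq : q ∈ T.P1) (v : Pt d) :
    Measurable fun x => lineDerivWithin ℝ q (closure Ω) x v := by
  let c : Pt d → (T.elements → Prop × Prop) := fun x K => (x ∈ dirSet K v, x ∈ dirSet K (-v))
  have hc : Measurable c := by
    refine measurable_pi_iff.2 fun K => Measurable.prodMk ?_ ?_
    · exact measurableSet_setOfPred.1 (measurableSet_dirSet _ _)
    · exact measurableSet_setOfPred.1 (measurableSet_dirSet _ _)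
  let f : Pt d → ℝ := fun x => lineDerivWithin ℝ q (closure Ω) x v
  have hfac : Function.FactorsThrough f c := by
    intro x y hxy
    refine lineDerivWithin_congr_of_dirSet hq (fun K hK => ?_) fun K hK => ?_
    · exact iff_of_eq (congrArg Prod.fst (congrFun hxy ⟨K, hK⟩))
    · exact iff_of_eq (congrArg Prod.snd (congrFun hxy ⟨K, hK⟩))
  have heq : f = Function.extend c f 0 ∘ c := by
    ext x
    exact (hfac.extend_apply 0 x).symm
  change Measurable f
  rw [heq]
  exact (measurable_of_countable _).comp hc

end Triangulation

end DirectionalDerivative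

/-! ### Sums with finite overlap -/

-- Cauchy-Schwarz in each local sum costs the number `N` of its terms; exchanging the sums costs the
-- number `M` of local sums in which a term occurs.
open Classical in
theorem sum_sq_sum_filter_le {α β : Type*} {V : Finset α} {E : Finset β} (R : α → β → Prop)
    (a : β → ℝ) {N M : ℝ} (hN0 : 0 ≤ N) (hN : ∀ p ∈ V, ((E.filter (R p)).card : ℝ) ≤ N)
    (hM : ∀ K ∈ E, ((V.filter fun p => R p K).card : ℝ) ≤ M) :
    ∑ p ∈ V, (∑ K ∈ E.filter (R p), a K) ^ 2 ≤ N * M * ∑ K ∈ E, a K ^ 2 := by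
  calc ∑ p ∈ V, (∑ K ∈ E.filter (R p), a K) ^ 2
      ≤ ∑ p ∈ V, N * ∑ K ∈ E.filter (R p), a K ^ 2 := by
        refine Finset.sum_le_sum fun p hp => sq_sum_le_card_mul_sum_sq.trans ?_
        exact mul_le_mul_of_nonneg_right (hN p hp) (Finset.sum_nonneg fun _ _ => sq_nonneg _)
    _ = N * ∑ K ∈ E, ∑ _p ∈ V.filter (fun p => R p K), a K ^ 2 := by
        rw [← Finset.mul_sum]
        congr 1
        refine Finset.sum_comm' fun p K => ?_
        simp only [Finset.mem_filter]
        tauto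
    _ ≤ N * ∑ K ∈ E, M * a K ^ 2 := by
        refine mul_le_mul_of_nonneg_left (Finset.sum_le_sum fun K hK => ?_) hN0
        rw [Finset.sum_const, nsmul_eq_mul]
        exact mul_le_mul_of_nonneg_right (hM K hK) (sq_nonneg _)
    _ = N * M * ∑ K ∈ E, a K ^ 2 := by rw [← Finset.mul_sum, mul_assoc]

theorem weighted_cauchy_schwarz {α : Type*} {V : Finset α} {a b : α → ℝ} {H A B X Y : ℝ}
    (hH : 0 ≤ H) (hA : 0 ≤ A) (hB : 0 ≤ B) (hX : 0 ≤ X) (hY : 0 ≤ Y)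
    (ha : H * ∑ p ∈ V, a p ^ 2 ≤ A * X ^ 2) (hb : H * ∑ p ∈ V, b p ^ 2 ≤ B * Y ^ 2) :
    H * ∑ p ∈ V, a p * b p ≤ √A * √B * (X * Y) := by
  calc H * ∑ p ∈ V, a p * b p
      ≤ H * (√(∑ p ∈ V, a p ^ 2) * √(∑ p ∈ V, b p ^ 2)) :=
        mul_le_mul_of_nonneg_left (Real.sum_mul_le_sqrt_mul_sqrt _ _ _) hH
    _ = √(H * ∑ p ∈ V, a p ^ 2) * √(H * ∑ p ∈ V, b p ^ 2) := by
        rw [Real.sqrt_mul hH, Real.sqrt_mul hH]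
        nth_rewrite 1 [← Real.mul_self_sqrt hH]
        ring
    _ ≤ √(A * X ^ 2) * √(B * Y ^ 2) := by gcongr
    _ = √A * √B * (X * Y) := by
        rw [Real.sqrt_mul hA, Real.sqrt_mul hB, Real.sqrt_sq hX, Real.sqrt_sq hY]; ring

theorem norm_le_sum_abs {d : ℕ} (x : Pt d) : ‖x‖ ≤ ∑ k, |x k| := by
  refine le_of_sq_le_sq ?_ (Finset.sum_nonneg fun _ _ => abs_nonneg _)
  rw [EuclideanSpace.real_norm_sq_eq]
  simp_rw [← sq_abs (x _)]
  exact Finset.sum_sq_le_sq_sum_of_nonneg fun _ _ => abs_nonneg _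

/-! ### Local patches and discrete norms. -/

namespace Triangulation

variable {d : ℕ} {Ω : Set (Pt d)} {T : Triangulation Ω} {σ δ κ : ℝ}

/-- The hypotheses on domain and mesh. -/
structure IsAdmissible (T : Triangulation Ω) (σ δ κ : ℝ) : Prop where
  dim_pos : 0 < d
  domain : IsPolyhedralDomain Ω
  delaunay : T.IsDelaunay
  boxes : T.BoxesInDomain
  regular : T.IsRegular σ δ κ
  shape_pos : 0 < σ
  uniform_pos : 0 < δ
  comparable_pos : 0 < κ

theorem IsAdmissible.meshSize_pos (hT : T.IsAdmissible σ δ κ) : 0 < T.meshSize :=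
  T.meshSize_pos hT.dim_pos hT.domain.isConnected.nonempty

open Classical in
/-- The vertices at distance at most `ρ` mesh sizes. -/
def nearVertices (T : Triangulation Ω) (ρ : ℝ) (p : Pt d) : Finset (Pt d) :=
  T.vertices.filter fun r => dist r p ≤ ρ * T.meshSize

open Classical in
/-- The elements close to a vertex. -/
def nearElements (T : Triangulation Ω) (p : Pt d) : Finset (Finset (Pt d)) :=
  T.elements.filter fun K => ∀ r ∈ K, dist r p ≤ 2 * T.meshSize

/-- Bound on the number of vertices in a ball whose radius is `ρ` mesh sizes. -/
def nearConst (d : ℕ) (δ κ ρ : ℝ) : ℝ := κ * (ρ + 1) ^ d * unitBallVol d / δ ^ d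

theorem nearConst_pos {ρ : ℝ} (hδ : 0 < δ) (hκ : 0 < κ) (hρ : 0 ≤ ρ) :
    0 < nearConst d δ κ ρ := by
  have := unitBallVol_pos d
  unfold nearConst
  positivity

theorem card_nearVertices_le (hT : T.IsAdmissible σ δ κ) {ρ : ℝ} (hρ : 0 ≤ ρ) (p : Pt d) :
    ((T.nearVertices ρ p).card : ℝ) ≤ nearConst d δ κ ρ :=
  card_vertices_near_le hT.regular hT.uniform_pos hT.comparable_pos hT.meshSize_pos
    hT.domain.isBounded p hρ fun r hr => by simpa [nearVertices] using hr

/-- An element is its vertex set, here a subset of the nearby vertices. -/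
theorem card_nearElements_le (hT : T.IsAdmissible σ δ κ) (p : Pt d) :
    ((T.nearElements p).card : ℝ) ≤ 2 ^ ⌊nearConst d δ κ 2⌋₊ := by
  have hsub : T.nearElements p ⊆ (T.nearVertices 2 p).powerset := by
    intro K hK
    simp only [nearElements, Finset.mem_filter] at hK
    refine Finset.mem_powerset.2 fun r hr => ?_
    simp only [nearVertices, Finset.mem_filter]
    exact ⟨mem_vertices.2 ⟨K, hK.1, hr⟩, hK.2 r hr⟩
  have h1 := Finset.card_le_card hsub
  rw [Finset.card_powerset] at h1
  have h2 : (T.nearVertices 2 p).card ≤ ⌊nearConst d δ κ 2⌋₊ :=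
    Nat.le_floor (card_nearVertices_le hT zero_le_two p)
  exact_mod_cast h1.trans (Nat.pow_le_pow_right two_pos h2)

/-- The sum of the gradients on the elements close to a vertex. -/
def nearSlope (T : Triangulation Ω) (q : Pt d → ℝ) (p : Pt d) : ℝ :=
  ∑ K ∈ T.nearElements p, slope q K

/-- The sum of the vertex values close to a vertex. -/
def nearValue (T : Triangulation Ω) (ρ : ℝ) (q : Pt d → ℝ) (p : Pt d) : ℝ :=
  ∑ r ∈ T.nearVertices ρ p, |q r|

/-- `nearSlope` for vector valued functions. -/
def nearSlopeVec (T : Triangulation Ω) (v : Pt d → Pt d) (p : Pt d) : ℝ :=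
  ∑ k, T.nearSlope (fun x => v x k) p

theorem nearSlope_nonneg (q : Pt d → ℝ) (p : Pt d) : 0 ≤ T.nearSlope q p :=
  Finset.sum_nonneg fun _ _ => slope_nonneg _ _

theorem nearSlopeVec_nonneg (v : Pt d → Pt d) (p : Pt d) : 0 ≤ T.nearSlopeVec v p :=
  Finset.sum_nonneg fun _ _ => nearSlope_nonneg _ _

theorem nearValue_nonneg (ρ : ℝ) (q : Pt d → ℝ) (p : Pt d) : 0 ≤ T.nearValue ρ q p :=
  Finset.sum_nonneg fun _ _ => abs_nonneg _

theorem abs_le_nearValue {ρ : ℝ} (q : Pt d → ℝ) {p r : Pt d} (hr : r ∈ T.nearVertices ρ p) :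
    |q r| ≤ T.nearValue ρ q p :=
  Finset.single_le_sum (f := fun r => |q r|) (fun _ _ => abs_nonneg _) hr

theorem slope_le_nearSlope (q : Pt d → ℝ) {p : Pt d} {K : Finset (Pt d)}
    (hK : K ∈ T.nearElements p) : slope q K ≤ T.nearSlope q p :=
  Finset.single_le_sum (f := slope q) (fun _ _ => slope_nonneg _ _) hK

/-- The constant in `sum_nearSlope_sq_le`. -/
def slopeConst (d : ℕ) (σ δ κ : ℝ) : ℝ :=
  2 ^ ⌊nearConst d δ κ 2⌋₊ * nearConst d δ κ 2 / (unitBallVol d * (σ * δ) ^ d)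

/-- The constant in `sum_nearValue_sq_le`. -/
def valueConst (d : ℕ) (σ δ κ ρ : ℝ) : ℝ :=
  nearConst d δ κ ρ * nearConst d δ κ ρ * ((d + 1) * (8 * 2 ^ d + 2))
    / (unitBallVol d * (σ * δ) ^ d)

theorem slopeConst_pos (hσ : 0 < σ) (hδ : 0 < δ) (hκ : 0 < κ) : 0 < slopeConst d σ δ κ := by
  have := unitBallVol_pos d
  have := nearConst_pos (d := d) hδ hκ zero_le_two
  unfold slopeConst
  positivity

theorem valueConst_pos {ρ : ℝ} (hσ : 0 < σ) (hδ : 0 < δ) (hκ : 0 < κ) (hρ : 0 ≤ ρ) :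
    0 < valueConst d σ δ κ ρ := by
  have := unitBallVol_pos d
  have := nearConst_pos (d := d) hδ hκ hρ
  unfold valueConst
  positivity

theorem sum_nearSlope_sq_le (hT : T.IsAdmissible σ δ κ) {q : Pt d → ℝ} (hq : q ∈ T.P1) :
    T.meshSize ^ d * ∑ p ∈ T.vertices, T.nearSlope q p ^ 2
      ≤ slopeConst d σ δ κ * seminormH1 Ω q ^ 2 := by
  classical
  have hU := unitBallVol_pos d
  have hσ := hT.shape_pos
  have hδ := hT.uniform_pos
  have hh := hT.meshSize_pos
  have hn := nearConst_pos (d := d) hδ hT.comparable_pos zero_le_two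
  have h1 := sum_sq_sum_filter_le (V := T.vertices) (E := T.elements)
    (fun p K => ∀ r ∈ K, dist r p ≤ 2 * T.meshSize) (slope q)
    (N := 2 ^ ⌊nearConst d δ κ 2⌋₊) (M := nearConst d δ κ 2) (by positivity)
    (fun p _ => by
      refine le_trans (le_of_eq ?_) (card_nearElements_le hT p)
      congr 2
      ext K
      simp only [nearElements, Finset.mem_filter])
    (fun K hK => by
      obtain ⟨k, hk⟩ := Finset.card_pos.1 (by rw [T.card_eq K hK]; omega : 0 < K.card)
      refine le_trans ?_ (card_nearVertices_le hT zero_le_two k)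
      refine Nat.cast_le.2 (Finset.card_le_card fun p hp => ?_)
      simp only [nearVertices, Finset.mem_filter] at hp ⊢
      exact ⟨hp.1, dist_comm k p ▸ hp.2 k hk⟩)
  have h2 := sum_slope_sq_le hT.regular hσ hδ hh hT.domain.interior_closure hq
  have h3 : T.meshSize ^ d * ∑ K ∈ T.elements, slope q K ^ 2
      ≤ seminormH1 Ω q ^ 2 / (unitBallVol d * (σ * δ) ^ d) := by
    rw [le_div_iff₀ (by positivity), mul_comm]; exact h2
  calc T.meshSize ^ d * ∑ p ∈ T.vertices, T.nearSlope q p ^ 2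
      ≤ T.meshSize ^ d * (2 ^ ⌊nearConst d δ κ 2⌋₊ * nearConst d δ κ 2 *
          ∑ K ∈ T.elements, slope q K ^ 2) := by
        refine mul_le_mul_of_nonneg_left (le_trans (le_of_eq ?_) h1) (by positivity)
        refine Finset.sum_congr rfl fun p _ => ?_
        rw [nearSlope]
        congr 2
        ext K
        simp only [nearElements, Finset.mem_filter]
    _ = 2 ^ ⌊nearConst d δ κ 2⌋₊ * nearConst d δ κ 2 *
          (T.meshSize ^ d * ∑ K ∈ T.elements, slope q K ^ 2) := by ring
    _ ≤ 2 ^ ⌊nearConst d δ κ 2⌋₊ * nearConst d δ κ 2 *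
          (seminormH1 Ω q ^ 2 / (unitBallVol d * (σ * δ) ^ d)) := by gcongr
    _ = _ := by rw [slopeConst]; ring

theorem sum_nearValue_sq_le (hT : T.IsAdmissible σ δ κ) {ρ : ℝ} (hρ : 0 ≤ ρ) {q : Pt d → ℝ}
    (hq : q ∈ T.P1) :
    T.meshSize ^ d * ∑ p ∈ T.vertices, T.nearValue ρ q p ^ 2
      ≤ valueConst d σ δ κ ρ * normL2 Ω q ^ 2 := by
  classical
  have hU := unitBallVol_pos d
  have hσ := hT.shape_pos
  have hδ := hT.uniform_pos
  have hh := hT.meshSize_pos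
  have hn := nearConst_pos (d := d) hδ hT.comparable_pos hρ
  have h1 := sum_sq_sum_filter_le (V := T.vertices) (E := T.vertices)
    (fun p r => dist r p ≤ ρ * T.meshSize) (fun r => |q r|)
    (N := nearConst d δ κ ρ) (M := nearConst d δ κ ρ) hn.le
    (fun p _ => by
      refine le_trans (le_of_eq ?_) (card_nearVertices_le hT hρ p)
      congr 2)
    (fun r _ => by
      refine le_trans ?_ (card_nearVertices_le hT hρ r)
      refine Nat.cast_le.2 (Finset.card_le_card fun p hp => ?_)
      simp only [nearVertices, Finset.mem_filter] at hp ⊢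
      exact ⟨hp.1, dist_comm r p ▸ hp.2⟩)
  simp_rw [sq_abs] at h1
  have h2 := sum_vertex_sq_le hT.regular hσ hδ hh hT.domain.interior_closure hq
  have h3 : T.meshSize ^ d * ∑ r ∈ T.vertices, q r ^ 2
      ≤ (d + 1) * (8 * 2 ^ d + 2) * normL2 Ω q ^ 2 / (unitBallVol d * (σ * δ) ^ d) := by
    rw [le_div_iff₀ (by positivity), mul_comm]; exact h2
  calc T.meshSize ^ d * ∑ p ∈ T.vertices, T.nearValue ρ q p ^ 2
      ≤ T.meshSize ^ d * (nearConst d δ κ ρ * nearConst d δ κ ρ * ∑ r ∈ T.vertices, q r ^ 2) := by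
        refine mul_le_mul_of_nonneg_left (le_trans (le_of_eq ?_) h1) (by positivity)
        refine Finset.sum_congr rfl fun p _ => ?_
        rw [nearValue]
        congr 2
    _ = nearConst d δ κ ρ * nearConst d δ κ ρ *
          (T.meshSize ^ d * ∑ r ∈ T.vertices, q r ^ 2) := by ring
    _ ≤ nearConst d δ κ ρ * nearConst d δ κ ρ *
          ((d + 1) * (8 * 2 ^ d + 2) * normL2 Ω q ^ 2 / (unitBallVol d * (σ * δ) ^ d)) := by
        gcongr
    _ = _ := by rw [valueConst]; ring

theorem sum_nearSlopeVec_sq_le (hT : T.IsAdmissible σ δ κ) {v : Pt d → Pt d} (hv : v ∈ T.P1Vec) :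
    T.meshSize ^ d * ∑ p ∈ T.vertices, T.nearSlopeVec v p ^ 2
      ≤ d * slopeConst d σ δ κ * seminormH1Vec Ω v ^ 2 := by
  have hh := hT.meshSize_pos
  rw [seminormH1Vec, Real.sq_sqrt (Finset.sum_nonneg fun _ _ => sq_nonneg _)]
  calc T.meshSize ^ d * ∑ p ∈ T.vertices, T.nearSlopeVec v p ^ 2
      ≤ T.meshSize ^ d * ∑ p ∈ T.vertices, d * ∑ k, T.nearSlope (fun x => v x k) p ^ 2 := by
        gcongr with p
        refine sq_sum_le_card_mul_sum_sq.trans_eq ?_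
        rw [Finset.card_univ, Fintype.card_fin]
    _ = d * ∑ k, T.meshSize ^ d * ∑ p ∈ T.vertices, T.nearSlope (fun x => v x k) p ^ 2 := by
        rw [← Finset.mul_sum, Finset.sum_comm, ← Finset.mul_sum]; ring
    _ ≤ d * ∑ k, slopeConst d σ δ κ * seminormH1 Ω (fun x => v x k) ^ 2 := by
        exact mul_le_mul_of_nonneg_left
          (Finset.sum_le_sum fun k _ => sum_nearSlope_sq_le hT (hv k)) (Nat.cast_nonneg d)
    _ = _ := by rw [← Finset.mul_sum]; ring

theorem sum_interior_sq_le (hT : T.IsAdmissible σ δ κ) (z : Pt d → ℝ) :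
    T.meshSize ^ d * ∑ p ∈ T.interiorVertices, |z p| ^ 2
      ≤ κ / δ ^ d * normL2 Ω (T.boxFun (T.lump z)) ^ 2 := by
  have hδ := hT.uniform_pos
  have hκ := hT.comparable_pos
  have hh := hT.meshSize_pos
  rw [normL2_boxFun_sq hT.domain.isBounded hT.domain.interior_closure, Finset.mul_sum,
    Finset.mul_sum]
  refine Finset.sum_le_sum fun p hp => ?_
  rw [lump, if_pos hp, sq_abs]
  have h := (cellVol_bounds hT.regular hδ hκ hh.le (mem_interiorVertices.1 hp).1).1
  calc T.meshSize ^ d * z p ^ 2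
      = κ / δ ^ d * (κ⁻¹ * (δ * T.meshSize) ^ d * z p ^ 2) := by
        rw [mul_pow]; field_simp
    _ ≤ _ := by gcongr

/-! ### Local bounds for neighbouring vertices. -/

/-- Explains the radius `2 h` in `nearElements`: one `h` from the vertex of the cell to `x`, another
across the element. -/
theorem mem_nearElements_of_mem_cell {p x : Pt d} {K : Finset (Pt d)} (hK : K ∈ T.elements)
    (hxp : x ∈ T.cell p) (hx : x ∈ simplex K) : K ∈ T.nearElements p := by
  simp only [nearElements, Finset.mem_filter]
  refine ⟨hK, fun r hr => (dist_triangle r x p).trans ?_⟩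
  have h1 := dist_le_meshSize hK (subset_simplex hr) hx
  have h2 := dist_le_of_mem_cell hxp
  linarith

theorem vertex_mem_cell {p : Pt d} (hp : p ∈ T.vertices) : p ∈ T.cell p :=
  ⟨fun r _ => by rw [dist_self]; exact dist_nonneg, vertex_mem_closure hp⟩

theorem mem_nearElements_of_mem {p : Pt d} {K : Finset (Pt d)} (hK : K ∈ T.elements)
    (hp : p ∈ K) : K ∈ T.nearElements p :=
  mem_nearElements_of_mem_cell hK (vertex_mem_cell (mem_vertices.2 ⟨K, hK, hp⟩)) (subset_simplex hp)

theorem norm_normal_le (p r : Pt d) : ‖normal p r‖ ≤ 1 := by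
  by_cases h : p = r
  · simp [normal, h]
  · exact (norm_normal h).le

theorem abs_normalDeriv_le {q : Pt d → ℝ} (hq : q ∈ T.P1) {p r x : Pt d} (hx : x ∈ T.face p r) :
    |normalDeriv Ω q p r x| ≤ T.nearSlope q p := by
  classical
  refine (abs_lineDerivWithin_le hq (norm_normal_le p r)).trans ?_
  refine Finset.sum_le_sum_of_subset_of_nonneg (fun K hK => ?_) fun _ _ _ => slope_nonneg _ _
  obtain ⟨hK, hxK⟩ := Finset.mem_filter.1 hK
  exact mem_nearElements_of_mem_cell hK hx.1 hxK

theorem normalDeriv_comm (q : Pt d → ℝ) (p r x : Pt d) :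
    normalDeriv Ω q r p x = -normalDeriv Ω q p r x := by
  rw [normalDeriv, normal_comm, lineDerivWithin_neg]
  rfl

theorem norm_sub_le_of_mem {v : Pt d → Pt d} (hv : v ∈ T.P1Vec) {K : Finset (Pt d)} {p r s : Pt d}
    (hs : K ∈ T.nearElements s) (hp : p ∈ K) (hr : r ∈ K) :
    ‖v p - v r‖ ≤ T.meshSize * T.nearSlopeVec v s := by
  have hK : K ∈ T.elements := Finset.mem_of_mem_filter K hs
  refine (norm_le_sum_abs _).trans ?_
  rw [nearSlopeVec, Finset.mul_sum]
  refine Finset.sum_le_sum fun k _ => ?_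
  have h1 := abs_sub_le_slope (hv k) hK (subset_simplex hp) (subset_simplex hr)
  refine h1.trans ?_
  rw [mul_comm]
  exact mul_le_mul (dist_le_meshSize hK (subset_simplex hp) (subset_simplex hr))
    (slope_le_nearSlope _ hs) (slope_nonneg _ _)
    (dist_nonneg.trans (dist_le_meshSize hK (subset_simplex hp) (subset_simplex hr)))

theorem norm_sub_le_of_interior (hT : T.IsAdmissible σ δ κ) {v : Pt d → Pt d} (hv : v ∈ T.P1Vec)
    {p r : Pt d} (hp : p ∈ T.interiorVertices) (hr : r ∈ T.nbrs p) :
    ‖v p - v r‖ ≤ T.meshSize * T.nearSlopeVec v p := by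
  obtain ⟨K, hK, hpK, hrK⟩ := exists_element_of_nbr hT.delaunay hT.domain.isOpen hp hr
  exact norm_sub_le_of_mem hv (mem_nearElements_of_mem hK hpK) hpK hrK

theorem eq_zero_of_not_interior (hT : T.IsAdmissible σ δ κ) {w : Pt d → Pt d} (hw : w ∈ T.P1Vec0)
    {p : Pt d} (hp : p ∈ T.vertices) (hpi : p ∉ T.interiorVertices) : w p = 0 := by
  refine hw.2 p ⟨vertex_mem_closure hp, fun h => hpi ?_⟩
  rw [hT.domain.isOpen.interior_eq] at h
  exact mem_interiorVertices.2 ⟨hp, h⟩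

/-- Two boundary vertices can be Voronoi neighbours without sharing an edge, but there both values
vanish. -/
theorem norm_sub_le_of_vanishing (hT : T.IsAdmissible σ δ κ) {w : Pt d → Pt d}
    (hw : w ∈ T.P1Vec0) {p r : Pt d} (hp : p ∈ T.vertices) (hr : r ∈ T.nbrs p) :
    ‖w p - w r‖ ≤ T.meshSize * T.nearSlopeVec w p := by
  by_cases hpi : p ∈ T.interiorVertices
  · exact norm_sub_le_of_interior hT hw.1 hpi hr
  by_cases hri : r ∈ T.interiorVertices
  · obtain ⟨K, hK, hrK, hpK⟩ :=
      exists_element_of_nbr hT.delaunay hT.domain.isOpen hri (nbrs_symm hp hr)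
    exact norm_sub_le_of_mem hw.1 (mem_nearElements_of_mem hK hpK) hpK hrK
  · rw [eq_zero_of_not_interior hT hw hp hpi,
      eq_zero_of_not_interior hT hw (mem_nbrs.1 hr).1 hri, sub_zero, norm_zero]
    exact mul_nonneg hT.meshSize_pos.le (nearSlopeVec_nonneg _ _)

theorem nbrs_subset_nearVertices (hT : T.IsAdmissible σ δ κ) {p : Pt d} (hp : p ∈ T.vertices) :
    T.nbrs p ⊆ T.nearVertices κ p := by
  intro r hr
  simp only [nearVertices, Finset.mem_filter]
  exact ⟨(mem_nbrs.1 hr).1, dist_comm r p ▸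
    (dist_nbr_bounds hT.regular hT.uniform_pos hT.comparable_pos hT.meshSize_pos.le hp hr).2⟩

theorem card_nbrs_le (hT : T.IsAdmissible σ δ κ) {p : Pt d} (hp : p ∈ T.vertices) :
    ((T.nbrs p).card : ℝ) ≤ nearConst d δ κ κ :=
  (Nat.cast_le.2 (Finset.card_le_card (nbrs_subset_nearVertices hT hp))).trans
    (card_nearVertices_le hT hT.comparable_pos.le p)

theorem self_mem_nearVertices (hT : T.IsAdmissible σ δ κ) {ρ : ℝ} (hρ : 0 ≤ ρ) {p : Pt d}
    (hp : p ∈ T.vertices) : p ∈ T.nearVertices ρ p := by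
  simp only [nearVertices, Finset.mem_filter, dist_self]
  exact ⟨hp, mul_nonneg hρ hT.meshSize_pos.le⟩

/-- The stabilization also uses the Gauss-Green gradient at a neighbour, hence neighbours of
neighbours: this is the source of the radius `2 * κ`. -/
theorem nearValue_nbr_le (hT : T.IsAdmissible σ δ κ) (q : Pt d → ℝ) {p r : Pt d}
    (hp : p ∈ T.vertices) (hr : r ∈ T.nbrs p) :
    T.nearValue κ q r ≤ T.nearValue (2 * κ) q p := by
  have h := (Finset.mem_filter.1 (nbrs_subset_nearVertices hT hp hr)).2
  refine Finset.sum_le_sum_of_subset_of_nonneg (fun s hs => ?_) fun _ _ _ => abs_nonneg _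
  simp only [nearVertices, Finset.mem_filter] at hs ⊢
  refine ⟨hs.1, (dist_triangle s r p).trans ?_⟩
  linarith [hs.2]

theorem nearValue_mono (hT : T.IsAdmissible σ δ κ) (q : Pt d → ℝ) (p : Pt d) :
    T.nearValue κ q p ≤ T.nearValue (2 * κ) q p := by
  refine Finset.sum_le_sum_of_subset_of_nonneg (fun s hs => ?_) fun _ _ _ => abs_nonneg _
  simp only [nearVertices, Finset.mem_filter] at hs ⊢
  refine ⟨hs.1, hs.2.trans ?_⟩
  have := mul_pos hT.comparable_pos hT.meshSize_pos
  linarith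

theorem interp_eq {F : Type} [AddCommGroup F] [Module ℝ F] (v : Pt d → F) {p r : Pt d}
    (h : p ≠ r) : interp v p r = (2⁻¹ : ℝ) • (v p + v r) := by
  rw [interp, weight_eq_half h, smul_add]
  norm_num

theorem interp_comm {F : Type} [AddCommGroup F] [Module ℝ F] (v : Pt d → F) {p r : Pt d}
    (h : p ≠ r) : interp v r p = interp v p r := by
  rw [interp_eq v h, interp_eq v h.symm, add_comm]

theorem abs_interp_le (hT : T.IsAdmissible σ δ κ) (q : Pt d → ℝ) {p r : Pt d}
    (hp : p ∈ T.vertices) (hr : r ∈ T.nbrs p) : |interp q p r| ≤ T.nearValue κ q p := by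
  have h1 := abs_le_nearValue q (self_mem_nearVertices hT hT.comparable_pos.le hp)
  have h2 := abs_le_nearValue q (nbrs_subset_nearVertices hT hp hr)
  rw [interp_eq q (mem_nbrs.1 hr).2.1.symm, smul_eq_mul, abs_mul, abs_of_pos (by norm_num)]
  have := abs_add_le (q p) (q r)
  linarith

theorem faceArea_le (hT : T.IsAdmissible σ δ κ) {p r : Pt d} (hp : p ∈ T.vertices)
    (hr : r ∈ T.nbrs p) : T.faceArea p r ≤ κ * T.meshSize ^ (d - 1) :=
  (faceArea_bounds hT.regular hT.uniform_pos hT.comparable_pos hT.meshSize_pos.le hp hr).2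

theorem meshSize_pow (hT : T.IsAdmissible σ δ κ) :
    T.meshSize ^ d = T.meshSize ^ (d - 1) * T.meshSize := by
  rw [← pow_succ, Nat.sub_add_cancel hT.dim_pos]

/-! ### Antisymmetric sums over faces -/

theorem sum_nbrs_comm {M : Type*} [AddCommMonoid M] (f : Pt d → Pt d → M) :
    ∑ p ∈ T.vertices, ∑ r ∈ T.nbrs p, f p r = ∑ p ∈ T.vertices, ∑ r ∈ T.nbrs p, f r p := by
  refine Finset.sum_comm' fun p r => ?_
  constructor
  · rintro ⟨hp, hr⟩
    exact ⟨nbrs_symm hp hr, (mem_nbrs.1 hr).1⟩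
  · rintro ⟨hp, hr⟩
    exact ⟨(mem_nbrs.1 hp).1, nbrs_symm hr hp⟩

/-- Summation by parts on the dual mesh; the factor `2⁻¹` appears because each face is met from both
sides. -/
theorem sum_inner_antisymm {J : Pt d → Pt d → Pt d} {a : Pt d → Pt d}
    (hJ : ∀ p ∈ T.vertices, ∀ r ∈ T.nbrs p, J r p = -J p r) :
    ∑ p ∈ T.vertices, ∑ r ∈ T.nbrs p, ⟪J p r, a p⟫ =
      2⁻¹ * ∑ p ∈ T.vertices, ∑ r ∈ T.nbrs p, ⟪J p r, a p - a r⟫ := by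
  have h : ∑ p ∈ T.vertices, ∑ r ∈ T.nbrs p, ⟪J p r, a r⟫ =
      -∑ p ∈ T.vertices, ∑ r ∈ T.nbrs p, ⟪J p r, a p⟫ := by
    rw [sum_nbrs_comm, ← Finset.sum_neg_distrib]
    refine Finset.sum_congr rfl fun p hp => ?_
    rw [← Finset.sum_neg_distrib]
    refine Finset.sum_congr rfl fun r hr => ?_
    rw [hJ p hp r hr, inner_neg_left]
  simp_rw [inner_sub_right, Finset.sum_sub_distrib]
  rw [h]
  ring

/-- A sum over faces of antisymmetric fluxes tested with vertex values. -/
theorem abs_sum_inner_le (hT : T.IsAdmissible σ δ κ) {J : Pt d → Pt d → Pt d} {w : Pt d → Pt d}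
    {α : Pt d → ℝ} (hw : w ∈ T.P1Vec0)
    (hJ : ∀ p ∈ T.vertices, ∀ r ∈ T.nbrs p, J r p = -J p r)
    (hα0 : ∀ p ∈ T.vertices, 0 ≤ α p)
    (hα : ∀ p ∈ T.vertices, ∀ r ∈ T.nbrs p, ‖J p r‖ ≤ T.meshSize ^ (d - 1) * α p) :
    |∑ p ∈ T.interiorVertices, ∑ r ∈ T.nbrs p, ⟪J p r, w p⟫| ≤
      nearConst d δ κ κ * (T.meshSize ^ d * ∑ p ∈ T.vertices, α p * T.nearSlopeVec w p) := by
  have hh := hT.meshSize_pos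
  -- The antisymmetry argument needs a sum over all vertices; the boundary ones may be added because
  -- `w` vanishes there.
  have hext : ∑ p ∈ T.interiorVertices, ∑ r ∈ T.nbrs p, ⟪J p r, w p⟫ =
      ∑ p ∈ T.vertices, ∑ r ∈ T.nbrs p, ⟪J p r, w p⟫ := by
    refine Finset.sum_subset (fun p hp => (mem_interiorVertices.1 hp).1) fun p hp hpi => ?_
    refine Finset.sum_eq_zero fun r _ => ?_
    rw [eq_zero_of_not_interior hT hw hp hpi, inner_zero_right]
  rw [hext, sum_inner_antisymm hJ, abs_mul, abs_of_pos (by norm_num : (0 : ℝ) < 2⁻¹)]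
  have hin : ∀ p ∈ T.vertices, |∑ r ∈ T.nbrs p, ⟪J p r, w p - w r⟫| ≤
      nearConst d δ κ κ * (T.meshSize ^ d * (α p * T.nearSlopeVec w p)) := by
    intro p hp
    have hnn : 0 ≤ T.meshSize ^ d * (α p * T.nearSlopeVec w p) :=
      mul_nonneg (by positivity) (mul_nonneg (hα0 p hp) (nearSlopeVec_nonneg _ _))
    refine (Finset.abs_sum_le_sum_abs _ _).trans ?_
    refine le_trans (Finset.sum_le_card_nsmul _ _
      (T.meshSize ^ d * (α p * T.nearSlopeVec w p)) fun r hr => ?_) ?_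
    · refine (abs_real_inner_le_norm _ _).trans ?_
      refine (mul_le_mul (hα p hp r hr) (norm_sub_le_of_vanishing hT hw hp hr) (norm_nonneg _)
        (mul_nonneg (by positivity) (hα0 p hp))).trans_eq ?_
      rw [meshSize_pow hT]; ring
    · rw [nsmul_eq_mul]
      exact mul_le_mul_of_nonneg_right (card_nbrs_le hT hp) hnn
  have hsum := (Finset.abs_sum_le_sum_abs _ _).trans (Finset.sum_le_sum hin)
  rw [← Finset.mul_sum, ← Finset.mul_sum] at hsum
  have habs := abs_nonneg (∑ p ∈ T.vertices, ∑ r ∈ T.nbrs p, ⟪J p r, w p - w r⟫)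
  linarith

/-! ### The viscous form -/

theorem integrableOn_normalDeriv {q : Pt d → ℝ} (hq : q ∈ T.P1) {p r : Pt d} (hr : r ∈ T.nbrs p) :
    IntegrableOn (normalDeriv Ω q p r) (T.face p r) (surface d) := by
  have hfin : surface d (T.face p r) < ⊤ := by
    have h := (mem_nbrs.1 hr).2.2
    rw [faceArea, Measure.real, ENNReal.toReal_pos_iff] at h
    exact h.2
  -- The normal derivative may jump between elements, so integrability comes from boundedness and
  -- measurability.
  refine IntegrableOn.of_bound hfin (measurable_lineDerivWithin hq _).aestronglyMeasurable
    (T.nearSlope q p) ?_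
  refine (ae_restrict_iff' ((isClosed_cell p).inter (isClosed_cell r)).measurableSet).2
    (Filter.Eventually.of_forall fun x hx => ?_)
  exact abs_normalDeriv_le hq hx

/-- The flux of `ν ∇v` through a face. -/
def viscousFlux (T : Triangulation Ω) (ν : ℝ) (v : Pt d → Pt d) (p r : Pt d) : Pt d :=
  WithLp.toLp 2 fun k => ν * ∫ x in T.face p r, normalDeriv Ω (fun y => v y k) p r x ∂(surface d)

theorem integral_eq_inner_viscousFlux {v : Pt d → Pt d} (hv : v ∈ T.P1Vec) (ν : ℝ) {p r : Pt d}
    (hr : r ∈ T.nbrs p) (W : Pt d) :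
    ∫ x in T.face p r, ν * ∑ k, normalDeriv Ω (fun y => v y k) p r x * W k ∂(surface d) =
      ⟪T.viscousFlux ν v p r, W⟫ := by
  rw [integral_const_mul, integral_finsetSum _ fun k _ =>
    (integrableOn_normalDeriv (hv k) hr).mul_const (W k), PiLp.inner_apply, Finset.mul_sum]
  refine Finset.sum_congr rfl fun k _ => ?_
  rw [integral_mul_const]
  simp only [viscousFlux, RCLike.inner_apply, conj_trivial]
  ring

theorem viscousFlux_comm (ν : ℝ) (v : Pt d → Pt d) (p r : Pt d) :
    T.viscousFlux ν v r p = -T.viscousFlux ν v p r := by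
  ext k
  simp only [viscousFlux, PiLp.neg_apply]
  rw [face_comm, integral_congr_ae (ae_of_all _ fun x => normalDeriv_comm (fun y => v y k) p r x),
    integral_neg]
  ring

theorem norm_viscousFlux_le (hT : T.IsAdmissible σ δ κ) {v : Pt d → Pt d} (hv : v ∈ T.P1Vec)
    {ν : ℝ} (hν : 0 < ν) {p r : Pt d} (hp : p ∈ T.vertices) (hr : r ∈ T.nbrs p) :
    ‖T.viscousFlux ν v p r‖ ≤ T.meshSize ^ (d - 1) * (ν * κ * T.nearSlopeVec v p) := by
  refine (norm_le_sum_abs _).trans ?_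
  rw [nearSlopeVec, Finset.mul_sum, Finset.mul_sum]
  refine Finset.sum_le_sum fun k _ => ?_
  have hfin : surface d (T.face p r) < ⊤ := by
    have h := (mem_nbrs.1 hr).2.2
    rw [faceArea, Measure.real, ENNReal.toReal_pos_iff] at h
    exact h.2
  have h1 : |∫ x in T.face p r, normalDeriv Ω (fun y => v y k) p r x ∂(surface d)| ≤
      T.nearSlope (fun y => v y k) p * T.faceArea p r := by
    rw [← Real.norm_eq_abs]
    exact norm_setIntegral_le_of_norm_le_const hfin fun x hx => abs_normalDeriv_le (hv k) hx
  change |ν * _| ≤ _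
  rw [abs_mul, abs_of_pos hν]
  have h2 := faceArea_le hT hp hr
  have h3 := nearSlope_nonneg (T := T) (fun y => v y k) p
  calc ν * |∫ x in T.face p r, normalDeriv Ω (fun y => v y k) p r x ∂(surface d)|
      ≤ ν * (T.nearSlope (fun y => v y k) p * (κ * T.meshSize ^ (d - 1))) := by
        refine mul_le_mul_of_nonneg_left (h1.trans ?_) hν.le
        exact mul_le_mul_of_nonneg_left h2 h3
    _ = _ := by ring

theorem abs_aB_le (hT : T.IsAdmissible σ δ κ) {ν : ℝ} (hν : 0 < ν) {v w : Pt d → Pt d}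
    (hv : v ∈ T.P1Vec) (hw : w ∈ T.P1Vec0) :
    |T.aB ν v (T.lump w)| ≤ nearConst d δ κ κ * (ν * κ) *
      (T.meshSize ^ d * ∑ p ∈ T.vertices, T.nearSlopeVec v p * T.nearSlopeVec w p) := by
  have hκ := hT.comparable_pos
  have heq : ∑ p ∈ T.interiorVertices, ∑ r ∈ T.nbrs p, ∫ x in T.face p r,
      ν * ∑ k, normalDeriv Ω (fun y => v y k) p r x * T.lump w p k ∂(surface d) =
      ∑ p ∈ T.interiorVertices, ∑ r ∈ T.nbrs p, ⟪T.viscousFlux ν v p r, w p⟫ := by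
    refine Finset.sum_congr rfl fun p hp => Finset.sum_congr rfl fun r hr => ?_
    rw [lump, if_pos hp, integral_eq_inner_viscousFlux hv ν hr]
  rw [aB, abs_neg, heq]
  refine (abs_sum_inner_le hT hw (fun p _ r _ => viscousFlux_comm ν v p r)
    (fun p _ => mul_nonneg (by positivity) (nearSlopeVec_nonneg v p))
    (fun p hp r hr => norm_viscousFlux_le hT hv hν hp hr)).trans_eq ?_
  simp_rw [mul_assoc, ← Finset.mul_sum]
  ring

/-! ### The divergence forms -/

theorem abs_bB_le (hT : T.IsAdmissible σ δ κ) (q : Pt d → ℝ) {w : Pt d → Pt d}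
    (hw : w ∈ T.P1Vec0) :
    |T.bB (T.lump w) q| ≤ nearConst d δ κ κ * κ *
      (T.meshSize ^ d * ∑ p ∈ T.vertices, T.nearValue κ q p * T.nearSlopeVec w p) := by
  have hκ := hT.comparable_pos
  have hh := hT.meshSize_pos
  have heq : T.bB (T.lump w) q = ∑ p ∈ T.interiorVertices, ∑ r ∈ T.nbrs p,
      ⟪(T.faceArea p r * interp q p r) • normal p r, w p⟫ := by
    refine Finset.sum_congr rfl fun p hp => Finset.sum_congr rfl fun r _ => ?_
    rw [lump, if_pos hp, inner_smul_left, conj_trivial]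
  rw [heq]
  refine (abs_sum_inner_le hT (α := fun p => κ * T.nearValue κ q p)
    (J := fun p r => (T.faceArea p r * interp q p r) • normal p r) hw
    (fun p _ r hr => ?_) (fun p _ => mul_nonneg hκ.le (nearValue_nonneg _ _ _))
    (fun p hp r hr => ?_)).trans_eq ?_
  · rw [faceArea_comm, interp_comm q (mem_nbrs.1 hr).2.1.symm, normal_comm, smul_neg]
  · rw [norm_smul, Real.norm_eq_abs, abs_mul, abs_of_pos (mem_nbrs.1 hr).2.2]
    calc T.faceArea p r * |interp q p r| * ‖normal p r‖
        ≤ (κ * T.meshSize ^ (d - 1)) * T.nearValue κ q p * 1 := by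
          gcongr
          · exact mul_nonneg (by positivity) (nearValue_nonneg _ _ _)
          · exact faceArea_le hT hp hr
          · exact abs_interp_le hT q hp hr
          · exact norm_normal_le p r
      _ = _ := by ring
  · simp_rw [mul_assoc, ← Finset.mul_sum]
    ring

theorem abs_cB_le (hT : T.IsAdmissible σ δ κ) {v : Pt d → Pt d} (hv : v ∈ T.P1Vec)
    (z : Pt d → ℝ) :
    |T.cB v (T.lump z)| ≤ nearConst d δ κ κ * κ *
      (T.meshSize ^ d * ∑ p ∈ T.interiorVertices, T.nearSlopeVec v p * |z p|) := by
  have hκ := hT.comparable_pos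
  have hh := hT.meshSize_pos
  rw [cB, Finset.mul_sum, Finset.mul_sum]
  refine (Finset.abs_sum_le_sum_abs _ _).trans (Finset.sum_le_sum fun p hp => ?_)
  have hpv := (mem_interiorVertices.1 hp).1
  -- A constant field has no net flux out of a box; subtracting `v p` gains the factor `h` from the
  -- edge difference.
  have hdiv : ∑ r ∈ T.nbrs p, T.faceArea p r * ⟪v p, normal p r⟫ = 0 := by
    have h := sum_faceArea_smul_normal hT.domain.isBounded hT.boxes hp
    have h2 := congrArg (fun u => ⟪v p, u⟫) h
    simpa [inner_sum, inner_smul_right] using h2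
  have heq : ∑ r ∈ T.nbrs p, T.faceArea p r * ⟪interp v p r, normal p r⟫ * T.lump z p =
      (∑ r ∈ T.nbrs p, T.faceArea p r * ⟪interp v p r - v p, normal p r⟫) * z p := by
    simp_rw [inner_sub_left, mul_sub, Finset.sum_sub_distrib, hdiv, sub_zero]
    rw [Finset.sum_mul, lump, if_pos hp]
  rw [heq, abs_mul]
  have hnn := nearSlopeVec_nonneg (T := T) v p
  have hterm : |∑ r ∈ T.nbrs p, T.faceArea p r * ⟪interp v p r - v p, normal p r⟫| ≤
      nearConst d δ κ κ * (κ * T.meshSize ^ d * T.nearSlopeVec v p) := by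
    refine (Finset.abs_sum_le_sum_abs _ _).trans (le_trans (Finset.sum_le_card_nsmul _ _
      (κ * T.meshSize ^ d * T.nearSlopeVec v p) fun r hr => ?_) ?_)
    · have h1 : interp v p r - v p = (-2⁻¹ : ℝ) • (v p - v r) := by
        rw [interp_eq v (mem_nbrs.1 hr).2.1.symm]; module
      have h2 : |⟪interp v p r - v p, normal p r⟫| ≤ T.meshSize * T.nearSlopeVec v p := by
        refine (abs_real_inner_le_norm _ _).trans ?_
        rw [h1, norm_smul]
        have h3 := norm_sub_le_of_interior hT hv hp hr
        have h4 : ‖(-2⁻¹ : ℝ)‖ ≤ 1 := by norm_num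
        calc ‖(-2⁻¹ : ℝ)‖ * ‖v p - v r‖ * ‖normal p r‖ ≤ 1 * ‖v p - v r‖ * 1 := by
              gcongr
              exact norm_normal_le p r
          _ ≤ _ := by linarith
      rw [abs_mul, abs_of_pos (mem_nbrs.1 hr).2.2]
      calc T.faceArea p r * |⟪interp v p r - v p, normal p r⟫|
          ≤ (κ * T.meshSize ^ (d - 1)) * (T.meshSize * T.nearSlopeVec v p) :=
            mul_le_mul (faceArea_le hT hpv hr) h2 (abs_nonneg _) (by positivity)
        _ = _ := by rw [meshSize_pow hT]; ring
    · rw [nsmul_eq_mul]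
      exact mul_le_mul_of_nonneg_right (card_nbrs_le hT hpv) (by positivity)
  calc _ ≤ nearConst d δ κ κ * (κ * T.meshSize ^ d * T.nearSlopeVec v p) * |z p| :=
        mul_le_mul_of_nonneg_right hterm (abs_nonneg _)
    _ = _ := by ring

/-! ### The stabilization -/

/-- A single neighbour already gives `D_p` the order `h^(d-2)` from below. The extra factor
`h^(d-1)` avoids negative exponents. -/
theorem inv_diag_bounds (hT : T.IsAdmissible σ δ κ) {ν : ℝ} (hν : 0 < ν) {p r : Pt d}
    (hp : p ∈ T.vertices) (hr : r ∈ T.nbrs p) :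
    0 ≤ (T.diag ν p)⁻¹ ∧
      (T.diag ν p)⁻¹ * T.meshSize ^ (d - 1) ≤ κ ^ 2 / (ν * δ ^ (d - 1)) * T.meshSize := by
  have hκ := hT.comparable_pos
  have hδ := hT.uniform_pos
  have hh := hT.meshSize_pos
  have hterm : ∀ s ∈ T.nbrs p, 0 ≤ ν * T.faceArea p s / dist p s := fun s hs =>
    div_nonneg (mul_nonneg hν.le (mem_nbrs.1 hs).2.2.le) dist_nonneg
  have hlow : ν * (κ⁻¹ * (δ * T.meshSize) ^ (d - 1)) / (κ * T.meshSize) ≤ T.diag ν p := by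
    refine le_trans ?_ (Finset.single_le_sum hterm hr)
    have h1 := (faceArea_bounds hT.regular hδ hκ hh.le hp hr).1
    have h2 := (dist_nbr_bounds hT.regular hδ hκ hh.le hp hr).2
    have h3 : 0 < dist p r := dist_pos.2 (mem_nbrs.1 hr).2.1.symm
    have h4 := (mem_nbrs.1 hr).2.2
    exact div_le_div₀ (by positivity) (mul_le_mul_of_nonneg_left h1 hν.le) h3 h2
  have hpos : 0 < ν * (κ⁻¹ * (δ * T.meshSize) ^ (d - 1)) / (κ * T.meshSize) := by positivity
  refine ⟨inv_nonneg.2 (hpos.le.trans hlow), ?_⟩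
  have hinv := inv_anti₀ hpos hlow
  calc (T.diag ν p)⁻¹ * T.meshSize ^ (d - 1)
      ≤ (ν * (κ⁻¹ * (δ * T.meshSize) ^ (d - 1)) / (κ * T.meshSize))⁻¹ *
          T.meshSize ^ (d - 1) := mul_le_mul_of_nonneg_right hinv (by positivity)
    _ = _ := by
        rw [mul_pow]
        field_simp

theorem norm_gaussGreen_le (hT : T.IsAdmissible σ δ κ) (q : Pt d → ℝ) {p : Pt d}
    (hp : p ∈ T.vertices) :
    ‖T.gaussGreen q p‖ ≤ nearConst d δ κ κ * (κ * T.meshSize ^ (d - 1) * T.nearValue κ q p) := by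
  have hκ := hT.comparable_pos
  have hh := hT.meshSize_pos
  have hnn := nearValue_nonneg (T := T) κ q p
  refine (norm_sum_le _ _).trans (le_trans (Finset.sum_le_card_nsmul _ _
    (κ * T.meshSize ^ (d - 1) * T.nearValue κ q p) fun r hr => ?_) ?_)
  · rw [norm_smul, Real.norm_eq_abs, abs_mul, abs_of_pos (mem_nbrs.1 hr).2.2]
    calc T.faceArea p r * |interp q p r| * ‖normal p r‖
        ≤ (κ * T.meshSize ^ (d - 1)) * T.nearValue κ q p * 1 := by
          gcongr
          · exact faceArea_le hT hp hr
          · exact abs_interp_le hT q hp hr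
          · exact norm_normal_le p r
      _ = _ := mul_one _
  · rw [nsmul_eq_mul]
    exact mul_le_mul_of_nonneg_right (card_nbrs_le hT hp) (by positivity)

theorem norm_inv_diag_gaussGreen_le (hT : T.IsAdmissible σ δ κ) {ν : ℝ} (hν : 0 < ν)
    (q : Pt d → ℝ) {p r : Pt d} (hp : p ∈ T.vertices) (hr : r ∈ T.nbrs p) :
    (T.diag ν p)⁻¹ * ‖T.gaussGreen q p‖ ≤
      nearConst d δ κ κ * κ * (κ ^ 2 / (ν * δ ^ (d - 1))) * T.meshSize * T.nearValue κ q p := by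
  have hκ := hT.comparable_pos
  have hnn := nearValue_nonneg (T := T) κ q p
  have hM := nearConst_pos (d := d) hT.uniform_pos hκ hκ.le
  obtain ⟨h0, h1⟩ := inv_diag_bounds hT hν hp hr
  calc (T.diag ν p)⁻¹ * ‖T.gaussGreen q p‖
      ≤ (T.diag ν p)⁻¹ *
          (nearConst d δ κ κ * (κ * T.meshSize ^ (d - 1) * T.nearValue κ q p)) :=
        mul_le_mul_of_nonneg_left (norm_gaussGreen_le hT q hp) h0
    _ = nearConst d δ κ κ * κ * T.nearValue κ q p *
          ((T.diag ν p)⁻¹ * T.meshSize ^ (d - 1)) := by ring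
    _ ≤ nearConst d δ κ κ * κ * T.nearValue κ q p *
          (κ ^ 2 / (ν * δ ^ (d - 1)) * T.meshSize) := by gcongr
    _ = _ := by ring

theorem cellVol_inv_diag_le (hT : T.IsAdmissible σ δ κ) {ν : ℝ} (hν : 0 < ν)
    {p r : Pt d} (hp : p ∈ T.vertices) (hr : r ∈ T.nbrs p) :
    T.cellVol p * (T.diag ν p)⁻¹ ≤ κ * (κ ^ 2 / (ν * δ ^ (d - 1))) * T.meshSize ^ 2 := by
  have hκ := hT.comparable_pos
  have hh := hT.meshSize_pos
  obtain ⟨h0, h1⟩ := inv_diag_bounds hT hν hp hr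
  have h2 := (cellVol_bounds hT.regular hT.uniform_pos hκ hh.le hp).2
  calc T.cellVol p * (T.diag ν p)⁻¹ ≤ κ * T.meshSize ^ d * (T.diag ν p)⁻¹ :=
        mul_le_mul_of_nonneg_right h2 h0
    _ = κ * T.meshSize * ((T.diag ν p)⁻¹ * T.meshSize ^ (d - 1)) := by
        rw [meshSize_pow hT]; ring
    _ ≤ κ * T.meshSize * (κ ^ 2 / (ν * δ ^ (d - 1)) * T.meshSize) := by gcongr
    _ = _ := by ring

/-- The constant in `abs_sB_le`. -/
def stabConst (d : ℕ) (ν δ κ : ℝ) : ℝ :=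
  nearConst d δ κ κ * (nearConst d δ κ κ * κ ^ 2 * (κ ^ 2 / (ν * δ ^ (d - 1)))
    + 2 * κ ^ 3 * (κ ^ 2 / (ν * δ ^ (d - 1))) / δ)

theorem abs_stab_flux_le (hT : T.IsAdmissible σ δ κ) {ν : ℝ} (hν : 0 < ν) (q : Pt d → ℝ)
    {p r : Pt d} (hp : p ∈ T.vertices) (hr : r ∈ T.nbrs p) :
    |T.faceArea p r * ⟪(weight p r * (T.diag ν p)⁻¹) • T.gaussGreen q p
        + ((1 - weight p r) * (T.diag ν r)⁻¹) • T.gaussGreen q r, normal p r⟫| ≤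
      nearConst d δ κ κ * κ ^ 2 * (κ ^ 2 / (ν * δ ^ (d - 1))) * T.meshSize ^ d *
        T.nearValue (2 * κ) q p := by
  have hκ := hT.comparable_pos
  have hδ := hT.uniform_pos
  have hh := hT.meshSize_pos
  have hM := nearConst_pos (d := d) hδ hκ hκ.le
  have hnn := nearValue_nonneg (T := T) (2 * κ) q p
  obtain ⟨hrv, hrp, hpos⟩ := mem_nbrs.1 hr
  -- `r` may be a boundary vertex with a truncated cell; its face with `p` suffices to bound `D_r`
  -- from below.
  have hpr := nbrs_symm hp hr
  set B := nearConst d δ κ κ * κ * (κ ^ 2 / (ν * δ ^ (d - 1))) * T.meshSize with hB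
  have hB0 : 0 ≤ B := by positivity
  have h1 : (T.diag ν p)⁻¹ * ‖T.gaussGreen q p‖ ≤ B * T.nearValue (2 * κ) q p :=
    (norm_inv_diag_gaussGreen_le hT hν q hp hr).trans
      (mul_le_mul_of_nonneg_left (nearValue_mono hT q p) hB0)
  have h2 : (T.diag ν r)⁻¹ * ‖T.gaussGreen q r‖ ≤ B * T.nearValue (2 * κ) q p :=
    (norm_inv_diag_gaussGreen_le hT hν q hrv hpr).trans
      (mul_le_mul_of_nonneg_left (nearValue_nbr_le hT q hp hr) hB0)
  have h3 : ‖(weight p r * (T.diag ν p)⁻¹) • T.gaussGreen q p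
        + ((1 - weight p r) * (T.diag ν r)⁻¹) • T.gaussGreen q r‖ ≤
        B * T.nearValue (2 * κ) q p := by
    refine (norm_add_le _ _).trans ?_
    have i1 := (inv_diag_bounds hT hν hp hr).1
    have i2 := (inv_diag_bounds hT hν hrv hpr).1
    rw [weight_eq_half hrp.symm, norm_smul, norm_smul, Real.norm_of_nonneg (by positivity),
      Real.norm_of_nonneg (mul_nonneg (by norm_num) i2)]
    linarith
  rw [abs_mul, abs_of_pos hpos]
  calc _ ≤ (κ * T.meshSize ^ (d - 1)) * (B * T.nearValue (2 * κ) q p * 1) := by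
        refine mul_le_mul (faceArea_le hT hp hr) ((abs_real_inner_le_norm _ _).trans ?_)
          (abs_nonneg _) (by positivity)
        exact mul_le_mul h3 (norm_normal_le p r) (norm_nonneg _) (by positivity)
    _ = _ := by rw [hB, meshSize_pow hT]; ring

/-- The orders are `h^(d-1)` for the face, `h^2` for volume over `D`, and `h^(-1)` for the quotient:
together `h^d`, with the jump of `q` bounded by its values. -/
theorem abs_stab_diff_le (hT : T.IsAdmissible σ δ κ) {ν : ℝ} (hν : 0 < ν) (q : Pt d → ℝ)
    {p r : Pt d} (hp : p ∈ T.vertices) (hr : r ∈ T.nbrs p) :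
    |T.faceArea p r * (weight p r * T.cellVol p * (T.diag ν p)⁻¹
        + (1 - weight p r) * T.cellVol r * (T.diag ν r)⁻¹) * ((q r - q p) / dist p r)| ≤
      2 * κ ^ 3 * (κ ^ 2 / (ν * δ ^ (d - 1))) / δ * T.meshSize ^ d *
        T.nearValue (2 * κ) q p := by
  have hκ := hT.comparable_pos
  have hδ := hT.uniform_pos
  have hh := hT.meshSize_pos
  obtain ⟨hrv, hrp, hpos⟩ := mem_nbrs.1 hr
  have hpr := nbrs_symm hp hr
  have hnn := nearValue_nonneg (T := T) (2 * κ) q p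
  have h1 := cellVol_inv_diag_le hT hν hp hr
  have h2 := cellVol_inv_diag_le hT hν hrv hpr
  have i1 := (inv_diag_bounds hT hν hp hr).1
  have i2 := (inv_diag_bounds hT hν hrv hpr).1
  have j1 : 0 ≤ T.cellVol p := measureReal_nonneg
  have j2 : 0 ≤ T.cellVol r := measureReal_nonneg
  set B := κ * (κ ^ 2 / (ν * δ ^ (d - 1))) * T.meshSize ^ 2 with hB
  have hB0 : 0 ≤ B := by positivity
  have h3 : weight p r * T.cellVol p * (T.diag ν p)⁻¹
        + (1 - weight p r) * T.cellVol r * (T.diag ν r)⁻¹ ≤ B := by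
    rw [weight_eq_half hrp.symm]; linarith
  have h30 : 0 ≤ weight p r * T.cellVol p * (T.diag ν p)⁻¹
        + (1 - weight p r) * T.cellVol r * (T.diag ν r)⁻¹ := by
    rw [weight_eq_half hrp.symm]
    have : (0 : ℝ) ≤ 1 - 1 / 2 := by norm_num
    positivity
  have hq : |q r - q p| ≤ 2 * T.nearValue (2 * κ) q p := by
    have k1 := (abs_le_nearValue q (self_mem_nearVertices hT hκ.le hp)).trans (nearValue_mono hT q p)
    have k2 := (abs_le_nearValue q (nbrs_subset_nearVertices hT hp hr)).trans
      (nearValue_mono hT q p)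
    have := abs_sub (q r) (q p)
    linarith
  have hdist := (dist_nbr_bounds hT.regular hδ hκ hh.le hp hr).1
  have hquot : |(q r - q p) / dist p r| ≤
      2 * T.nearValue (2 * κ) q p / (κ⁻¹ * (δ * T.meshSize)) := by
    rw [abs_div, abs_of_nonneg dist_nonneg]
    exact div_le_div₀ (by positivity) hq (by positivity) hdist
  rw [abs_mul, abs_mul, abs_of_pos hpos, abs_of_nonneg h30]
  calc _ ≤ (κ * T.meshSize ^ (d - 1)) * B *
        (2 * T.nearValue (2 * κ) q p / (κ⁻¹ * (δ * T.meshSize))) := by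
        refine mul_le_mul (mul_le_mul (faceArea_le hT hp hr) h3 h30 (by positivity)) hquot
          (abs_nonneg _) (by positivity)
    _ = _ := by rw [hB, meshSize_pow hT]; field_simp

theorem abs_sB_le (hT : T.IsAdmissible σ δ κ) {ν : ℝ} (hν : 0 < ν) (q z : Pt d → ℝ) :
    |T.sB ν q (T.lump z)| ≤ stabConst d ν δ κ *
      (T.meshSize ^ d * ∑ p ∈ T.interiorVertices, T.nearValue (2 * κ) q p * |z p|) := by
  have hκ := hT.comparable_pos
  have hδ := hT.uniform_pos
  have hh := hT.meshSize_pos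
  have hM := nearConst_pos (d := d) hδ hκ hκ.le
  rw [sB, ← Finset.sum_sub_distrib, Finset.mul_sum, Finset.mul_sum]
  refine (Finset.abs_sum_le_sum_abs _ _).trans (Finset.sum_le_sum fun p hp => ?_)
  have hpv := (mem_interiorVertices.1 hp).1
  have hnn := nearValue_nonneg (T := T) (2 * κ) q p
  rw [← Finset.sum_sub_distrib]
  set E := nearConst d δ κ κ * κ ^ 2 * (κ ^ 2 / (ν * δ ^ (d - 1))) +
    2 * κ ^ 3 * (κ ^ 2 / (ν * δ ^ (d - 1))) / δ with hE
  have hE0 : 0 ≤ E := by positivity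
  refine (Finset.abs_sum_le_sum_abs _ _).trans (le_trans (Finset.sum_le_card_nsmul _ _
    (E * T.meshSize ^ d * T.nearValue (2 * κ) q p * |z p|) fun r hr => ?_) ?_)
  · rw [← sub_mul, abs_mul, lump, if_pos hp]
    refine mul_le_mul_of_nonneg_right ?_ (abs_nonneg _)
    have h1 := abs_stab_flux_le hT hν q hpv hr
    have h2 := abs_stab_diff_le hT hν q hpv hr
    refine (abs_sub _ _).trans ((add_le_add h1 h2).trans_eq ?_)
    rw [hE]; ring
  · rw [nsmul_eq_mul]
    refine (mul_le_mul_of_nonneg_right (card_nbrs_le hT hpv) (by positivity)).trans_eq ?_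
    rw [stabConst, ← hE]; ring

/-! ### Assembly of the four estimates. -/

/-- The continuity constant of the compact form. -/
def continuityConst (d : ℕ) (ν σ δ κ : ℝ) : ℝ :=
  nearConst d δ κ κ * (ν * κ) * (√(d * slopeConst d σ δ κ) * √(d * slopeConst d σ δ κ))
  + nearConst d δ κ κ * κ * (√(valueConst d σ δ κ κ) * √(d * slopeConst d σ δ κ))
  + nearConst d δ κ κ * κ * (√(d * slopeConst d σ δ κ) * √(κ / δ ^ d))
  + stabConst d ν δ κ * (√(valueConst d σ δ κ (2 * κ)) * √(κ / δ ^ d))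

theorem continuityConst_pos {ν : ℝ} (hd : 0 < d) (hν : 0 < ν) (hσ : 0 < σ) (hδ : 0 < δ)
    (hκ : 0 < κ) : 0 < continuityConst d ν σ δ κ := by
  have h1 := nearConst_pos (d := d) hδ hκ hκ.le
  have h2 := slopeConst_pos (d := d) hσ hδ hκ
  have h3 : (0 : ℝ) < d := Nat.cast_pos.2 hd
  have h4 : 0 < stabConst d ν δ κ := by unfold stabConst; positivity
  unfold continuityConst
  positivity

theorem boxNorm_bounds (w : Pt d → Pt d) (z : Pt d → ℝ) :
    seminormH1Vec Ω w ≤ T.boxNorm w z ∧ normL2 Ω (T.boxFun (T.lump z)) ≤ T.boxNorm w z := by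
  have h1 := sq_nonneg (seminormH1Vec Ω w)
  have h2 := sq_nonneg (normL2 Ω (T.boxFun (T.lump z)))
  have h3 := sq_nonneg (T.seminormStar z)
  exact ⟨Real.le_sqrt_of_sq_le (by linarith), Real.le_sqrt_of_sq_le (by linarith)⟩

theorem formC_le (hT : T.IsAdmissible σ δ κ) {ν : ℝ} (hν : 0 < ν) {v w : Pt d → Pt d}
    {q : Pt d → ℝ} (z : Pt d → ℝ) (hv : v ∈ T.P1Vec) (hw : w ∈ T.P1Vec0) (hq : q ∈ T.P1) :
    T.formC ν v q (T.lump w) (T.lump z) ≤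
      continuityConst d ν σ δ κ * (seminormH1Vec Ω v + normL2 Ω q) * T.boxNorm w z := by
  have hσ := hT.shape_pos
  have hδ := hT.uniform_pos
  have hκ := hT.comparable_pos
  have hh := hT.meshSize_pos
  have hM := nearConst_pos (d := d) hδ hκ hκ.le
  have hstab : 0 < stabConst d ν δ κ := by unfold stabConst; positivity
  have hH : 0 ≤ T.meshSize ^ d := by positivity
  have hS : 0 ≤ d * slopeConst d σ δ κ :=
    mul_nonneg (Nat.cast_nonneg d) (slopeConst_pos hσ hδ hκ).le
  have hV := (valueConst_pos (d := d) hσ hδ hκ hκ.le).le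
  have hV2 := (valueConst_pos (d := d) hσ hδ hκ (by positivity : 0 ≤ 2 * κ)).le
  have hZ : 0 ≤ κ / δ ^ d := by positivity
  obtain ⟨hbw, hbz⟩ := boxNorm_bounds (T := T) w z
  have hX : 0 ≤ seminormH1Vec Ω v := Real.sqrt_nonneg _
  have hW : 0 ≤ seminormH1Vec Ω w := Real.sqrt_nonneg _
  have hQ : 0 ≤ normL2 Ω q := Real.sqrt_nonneg _
  have hP : 0 ≤ normL2 Ω (T.boxFun (T.lump z)) := Real.sqrt_nonneg _
  -- The lumped `z` only controls interior vertices, so its partner's sum is restricted to them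
  -- before Cauchy-Schwarz.
  have hint : ∀ f : Pt d → ℝ, T.meshSize ^ d * ∑ p ∈ T.interiorVertices, f p ^ 2 ≤
      T.meshSize ^ d * ∑ p ∈ T.vertices, f p ^ 2 := fun f =>
    mul_le_mul_of_nonneg_left (Finset.sum_le_sum_of_subset_of_nonneg
      (fun p hp => (mem_interiorVertices.1 hp).1) fun _ _ _ => sq_nonneg _) hH
  have sv := sum_nearSlopeVec_sq_le hT hv
  have sw := sum_nearSlopeVec_sq_le hT hw.1
  have sz := sum_interior_sq_le hT z
  have sq1 := sum_nearValue_sq_le hT hκ.le hq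
  have sq2 := sum_nearValue_sq_le hT (by positivity : 0 ≤ 2 * κ) hq
  have ha := (abs_aB_le hT hν hv hw).trans (mul_le_mul_of_nonneg_left
    (weighted_cauchy_schwarz hH hS hS hX hW sv sw) (by positivity))
  have hb := (abs_bB_le hT q hw).trans (mul_le_mul_of_nonneg_left
    (weighted_cauchy_schwarz hH hV hS hQ hW sq1 sw) (by positivity))
  have hc := (abs_cB_le hT hv z).trans (mul_le_mul_of_nonneg_left
    (weighted_cauchy_schwarz hH hS hZ hX hP ((hint _).trans sv) sz) (by positivity))
  have hs := (abs_sB_le hT hν q z).trans (mul_le_mul_of_nonneg_left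
    (weighted_cauchy_schwarz hH hV2 hZ hQ hP ((hint _).trans sq2) sz) hstab.le)
  set N := T.boxNorm w z
  have hN : 0 ≤ N := hW.trans hbw
  have hform : T.formC ν v q (T.lump w) (T.lump z) ≤ |T.aB ν v (T.lump w)| +
      |T.bB (T.lump w) q| + |T.cB v (T.lump z)| + |T.sB ν q (T.lump z)| := by
    unfold formC
    linarith [le_abs_self (T.aB ν v (T.lump w)), le_abs_self (T.bB (T.lump w) q),
      le_abs_self (T.cB v (T.lump z)), le_abs_self (T.sB ν q (T.lump z))]
  have hprod : ∀ {x y : ℝ}, 0 ≤ x → x ≤ seminormH1Vec Ω v + normL2 Ω q → y ≤ N → 0 ≤ y →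
      x * y ≤ (seminormH1Vec Ω v + normL2 Ω q) * N := fun _ hx hy hy0 =>
    mul_le_mul hx hy hy0 (by positivity)
  have hXle : seminormH1Vec Ω v ≤ seminormH1Vec Ω v + normL2 Ω q := by linarith
  have hQle : normL2 Ω q ≤ seminormH1Vec Ω v + normL2 Ω q := by linarith
  calc T.formC ν v q (T.lump w) (T.lump z)
      ≤ |T.aB ν v (T.lump w)| + |T.bB (T.lump w) q| + |T.cB v (T.lump z)| +
          |T.sB ν q (T.lump z)| := hform
    _ ≤ _ := add_le_add (add_le_add (add_le_add ha hb) hc) hs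
    _ ≤ nearConst d δ κ κ * (ν * κ) * (√(d * slopeConst d σ δ κ) * √(d * slopeConst d σ δ κ) *
          ((seminormH1Vec Ω v + normL2 Ω q) * N))
        + nearConst d δ κ κ * κ * (√(valueConst d σ δ κ κ) * √(d * slopeConst d σ δ κ) *
          ((seminormH1Vec Ω v + normL2 Ω q) * N))
        + nearConst d δ κ κ * κ * (√(d * slopeConst d σ δ κ) * √(κ / δ ^ d) *
          ((seminormH1Vec Ω v + normL2 Ω q) * N))
        + stabConst d ν δ κ * (√(valueConst d σ δ κ (2 * κ)) * √(κ / δ ^ d) *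
          ((seminormH1Vec Ω v + normL2 Ω q) * N)) := by
        gcongr ?_ * (?_ * ?_) + ?_ * (?_ * ?_) + ?_ * (?_ * ?_) + ?_ * (?_ * ?_)
        · exact hprod hX hXle hbw hW
        · exact hprod hQ hQle hbw hW
        · exact hprod hX hXle hbz hP
        · exact hprod hQ hQle hbz hP
    _ = _ := by unfold continuityConst; ring

end Triangulation

end BoxMethod

end

theorem mainTheorem5 (d : ℕ) (hd : d = 2 ∨ d = 3) (Ω : Set (BoxMethod.Pt d))
    (hΩ : BoxMethod.IsPolyhedralDomain Ω) (ν : ℝ) (hν : 0 < ν)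
    (σ δ κ : ℝ) (hσ : 0 < σ) (hδ : 0 < δ) (hκ : 0 < κ) :
    ∃ C : ℝ, 0 < C ∧ ∀ T : BoxMethod.Triangulation Ω,
      T.IsDelaunay → T.BoxesInDomain → T.IsRegular σ δ κ →
      ∀ v ∈ T.P1Vec, ∀ w ∈ T.P1Vec0, ∀ q ∈ T.P1, ∀ z ∈ T.P1,
        T.formC ν v q (T.lump w) (T.lump z) ≤
          C * (BoxMethod.Triangulation.seminormH1Vec Ω v
              + BoxMethod.Triangulation.normL2 Ω q
              + √T.meshSize * BoxMethod.Triangulation.seminormH1 Ω q)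
            * T.boxNorm w z := by
  have hd0 : 0 < d := by omega
  have hC := BoxMethod.Triangulation.continuityConst_pos hd0 hν hσ hδ hκ
  refine ⟨_, hC, fun T hDel hbox hreg v hv w hw q hq z _ => ?_⟩
  refine (BoxMethod.Triangulation.formC_le ⟨hd0, hΩ, hDel, hbox, hreg, hσ, hδ, hκ⟩ hν z hv hw
    hq).trans ?_
  refine mul_le_mul_of_nonneg_right (mul_le_mul_of_nonneg_left ?_ hC.le) (Real.sqrt_nonneg _)
  exact le_add_of_nonneg_right (mul_nonneg (Real.sqrt_nonneg _) (Real.sqrt_nonneg _))
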